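/- For every $n\ge 5$ there exist convex symmetric bodies $K,L\subset\mathbb{R}^n$ (compact convex sets with nonempty interior, $K=-K$, $L=-L$), a strictly increasing convex function $\phi:[0,\infty)\to[0,\infty)$, and a log-concave Borel probability measure $\mu$ on $\mathbb{R}^n$ with density $f(x)=e^{-\phi(\|x\|_L)}$ with respect to Lebesgue measure, such that $$\int_{rK\cap\xi^\perp} f(x)\,dx\ \le\ \int_{rL\cap\xi^\perp} f(x)\,dx\qquad\text{for all }\xi\in\mathbb{S}^{n-1}\text{ and all } r>0,$$ but $\mu(K)>\mu(L)$. Here $\|x\|_L=\inf\{\lambda>0: x\in\lambda L\}$ is the Minkowski functional of $L$, $\xi^\perp$ is the central hyperplane perpendicular to $\xi$ and the integrals over its subsets are with respect to $(n-1)$-dimensional Lebesgue measure. Log-concavity of $\mu$ means $\mu(\lambda A+(1-\lambda)B)\ge\mu(A)^\lambda\mu(B)^{1-\lambda}$ for all nonempty compact $A,B\subset\mathbb{R}^n$ and all $0<\lambda<1$. -/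

import Mathlib

open scoped Pointwise

/-- A symmetric convex body in `ℝⁿ`: a compact convex set with nonempty interior and `K = -K`. -/
structure IsSymmConvexBody {n : ℕ} (K : Set (EuclideanSpace ℝ (Fin n))) : Prop where
  convex : Convex ℝ K
  isCompact : IsCompact K
  interior_nonempty : (interior K).Nonempty
  symm : K = -K

/-- A Borel measure on `ℝⁿ` is log-concave if `μ(λA + (1-λ)B) ≥ μ(A)^λ μ(B)^(1-λ)` for all
nonempty compact sets `A`, `B` and all `0 < λ < 1`. -/
def IsLogConcaveMeasure {n : ℕ} (μ : MeasureTheory.Measure (EuclideanSpace ℝ (Fin n))) : Prop :=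
  ∀ A B : Set (EuclideanSpace ℝ (Fin n)), IsCompact A → IsCompact B → A.Nonempty → B.Nonempty →
    ∀ t : ℝ, 0 < t → t < 1 → μ A ^ t * μ B ^ (1 - t) ≤ μ (t • A + (1 - t) • B)

/-- The density `x ↦ exp (-φ(‖x‖_L))`, where `‖x‖_L` is the Minkowski functional of `L`. -/
noncomputable def normDensity {n : ℕ} (φ : ℝ → ℝ) (L : Set (EuclideanSpace ℝ (Fin n)))
    (x : EuclideanSpace ℝ (Fin n)) : ENNReal :=
  ENNReal.ofReal (Real.exp (-φ (gauge L x)))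

/-- For a density `f` on `ℝⁿ`, the measure `∫_{A ∩ ξ^⊥} f(x) dx` of the section of `A` by the
central hyperplane orthogonal to `ξ`. The integral is with respect to the Lebesgue measure of
the Euclidean space `ξ^⊥`, the volume given by its inner product structure. -/
noncomputable def sectionMeasure {n : ℕ} (f : EuclideanSpace ℝ (Fin n) → ENNReal)
    (A : Set (EuclideanSpace ℝ (Fin n))) (ξ : EuclideanSpace ℝ (Fin n)) : ENNReal :=
  ∫⁻ x in {x : (Submodule.span ℝ {ξ})ᗮ | (x : EuclideanSpace ℝ (Fin n)) ∈ A}, f x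
    ∂(@MeasureTheory.volume (Submodule.span ℝ {ξ})ᗮ measureSpaceOfInnerProductSpace)

/-! The problem reduces to a Busemann–Petty pair for volume: symmetric convex bodies such that every
central section of `K` has at most the area of that of `L`, yet `volume L < volume K`. Given such a
pair, take `φ s = ε * s + c` with `c` normalizing (`exists_logConcave_of_section_le`). The density
decreases with the gauge of `L`, so `r • L` is a superlevel set and, in each hyperplane, carries at
least as much mass as any measurable set of no larger area (`setLIntegral_le_of_measure_le`). For
small `ε` the density is almost constant on `K` and `L`, so the strict volume inequality survives.
Log-concavity is Prékopa–Leindler.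

The pair comes from `exists_body_pair`, with `n = p + 1`. For a body `{Q ≤ 1}` with `Q`
2-homogeneous, section areas are spherical integrals of `Q ^ (-p / 2)` and the volume is one of `Q ^
(-(p + 1) / 2)`. Decreasing `Q ^ (-p / 2)` by `ε * w` does not increase any section if `w` has
nonnegative integral over every great subsphere, and to first order it changes the volume by a
negative multiple of `∫ Q ^ (-1 / 2) * w`. So one wants this integral negative, which says that the
body is not an intersection body.

The test function `w` is built from ellipsoid weights `W_β`. Over a great subsphere `W_β` integrates
to a constant times `(β * (1 - s) + s) ^ (-1 / 2)`, where `s` depends only on the hyperplane. This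
is convex in `β`, so `(1 - β) * W_β + β * W_1 - W_(2β - β²)` has nonnegative integrals
(`integral_sphere_signedWeight_nonneg`). The body is given by `√(a² + t⁴)`, where `t = ⟨e, x⟩` and
`a = |x|² - t²`. It is flat in the direction `e` along the equator `t = 0`, where `W_β` concentrates
as `β → 0`. Hence for `p ≥ 4` the pairing of its radial function with `W_β` starts with slope zero
at `β = 0`, although its value at `1` is smaller than at `0`. A convex function cannot do this, and
the chord inequality fails for small `β` (`exists_profile_integral_neg`). Small multiples `δ` added
to the form and to the weight leave room for convexity of the perturbed body and for second-order
errors. -/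

/-! ### Prékopa–Leindler and log-concave densities. -/

open MeasureTheory Set in
/-- The one-dimensional Brunn–Minkowski inequality for compact sets. -/
theorem volume_add_le_of_isCompact {A B C : Set ℝ} (hA : IsCompact A) (hB : IsCompact B)
    (hA' : A.Nonempty) (hB' : B.Nonempty) (h : ∀ a ∈ A, ∀ b ∈ B, a + b ∈ C) :
    volume A + volume B ≤ volume C := by
  -- The translates `A + min B` and `max A + B` both lie in `C` and can meet only at `max A + min
  -- B`.
  obtain ⟨a, haA, ha⟩ := hA.exists_isGreatest hA'
  obtain ⟨b, hbB, hb⟩ := hB.exists_isLeast hB'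
  have h1 : volume A = volume ((fun x => x + b) '' A) := by
    simp
  have h2 : volume B = volume ((fun x => a + x) '' B) := by
    simp
  have hd : AEDisjoint volume ((fun x => x + b) '' A) ((fun x => a + x) '' B) := by
    refine measure_mono_null (t := {a + b}) ?_ (by simp)
    rintro _ ⟨⟨x, hx, rfl⟩, ⟨y, hy, hxy⟩⟩
    have := ha hx
    have := hb hy
    simp only [mem_singleton_iff] at *
    linarith
  rw [h1, h2, ← measure_union₀ ((hB.image (by fun_prop)).measurableSet.nullMeasurableSet) hd]
  refine measure_mono ?_
  rintro _ (⟨x, hx, rfl⟩ | ⟨y, hy, rfl⟩)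
  · exact h x hx b hbB
  · exact h a haA y hy

open MeasureTheory Set in
theorem volume_add_le_of_measurableSet {A B C : Set ℝ} (hA : MeasurableSet A)
    (hB : MeasurableSet B) (hA' : A.Nonempty) (hB' : B.Nonempty)
    (h : ∀ a ∈ A, ∀ b ∈ B, a + b ∈ C) :
    volume A + volume B ≤ volume C := by
  obtain ⟨a, ha⟩ := hA'
  obtain ⟨b, hb⟩ := hB'
  have : Nonempty {K : Set ℝ // K ⊆ A ∧ IsCompact K} := ⟨⟨∅, by simp⟩⟩
  rw [hA.measure_eq_iSup_isCompact, hB.measure_eq_iSup_isCompact]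
  simp only [iSup_and']
  refine ENNReal.biSup_add_biSup_le' ⟨∅, by simp⟩ ⟨∅, by simp⟩ ?_
  rintro K ⟨hKA, hK⟩ K' ⟨hKB, hK'⟩
  -- The approximating compact sets may be empty, so a point of each set is inserted.
  calc volume K + volume K' ≤ volume (insert a K) + volume (insert b K') := by
        gcongr <;> exact subset_insert _ _
    _ ≤ volume C := volume_add_le_of_isCompact (hK.insert a) (hK'.insert b)
        (insert_nonempty _ _) (insert_nonempty _ _) fun x hx y hy =>
          h x (insert_subset ha hKA hx) y (insert_subset hb hKB hy)

open MeasureTheory Set in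
theorem lintegral_eq_setLIntegral_Ioo_measure_lt {α : Type*} [MeasurableSpace α] (μ : Measure α)
    {k : α → ENNReal} (hk : Measurable k) (hk1 : ∀ x, k x ≤ 1) :
    ∫⁻ x, k x ∂μ = ∫⁻ s in Ioo (0 : ℝ) 1, μ {x | ENNReal.ofReal s < k x} := by
  have hfin : ∀ x, k x ≠ ⊤ := fun x => ((hk1 x).trans_lt ENNReal.one_lt_top).ne
  have h1 : ∫⁻ x, k x ∂μ = ∫⁻ x, ENNReal.ofReal (k x).toReal ∂μ :=
    lintegral_congr fun x => (ENNReal.ofReal_toReal (hfin x)).symm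
  rw [h1, lintegral_eq_lintegral_meas_lt μ (ae_of_all _ fun x => ENNReal.toReal_nonneg)
    hk.ennreal_toReal.aemeasurable]
  have h2 : ∫⁻ s in Ioi (0 : ℝ), μ {x | s < (k x).toReal}
      = ∫⁻ s in Ioi (0 : ℝ), (Ioo (0 : ℝ) 1).indicator
        (fun s => μ {x | ENNReal.ofReal s < k x}) s := by
    refine setLIntegral_congr_fun measurableSet_Ioi fun s (hs : 0 < s) => ?_
    have hs' : (0 : ℝ) ≤ s := hs.le
    by_cases hs1 : s < 1
    · rw [indicator_of_mem (mem_Ioo.2 ⟨hs, hs1⟩)]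
      congr 1
      ext x
      exact (ENNReal.ofReal_lt_iff_lt_toReal hs' (hfin x)).symm
    · rw [indicator_of_notMem (fun h => hs1 h.2)]
      convert measure_empty (μ := μ)
      ext x
      simp only [mem_ofPred_eq, mem_empty_iff_false, iff_false, not_lt]
      refine le_trans ?_ (not_lt.1 hs1)
      exact ENNReal.toReal_mono ENNReal.one_ne_top (hk1 x)
  rw [h2, lintegral_indicator measurableSet_Ioo, Measure.restrict_restrict measurableSet_Ioo,
    inter_eq_left.2 (fun s hs => hs.1)]

open MeasureTheory Set in
theorem volume_smul_real {t : ℝ} (ht : 0 < t) (A : Set ℝ) :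
    volume (t • A) = ENNReal.ofReal t * volume A := by
  rw [Measure.addHaar_smul]
  simp [abs_of_pos ht]

theorem lt_rpow_mul_rpow_one_sub {s a b : ENNReal} {t : ℝ} (ht : 0 < t) (ht1 : t < 1)
    (ha : s < a) (hb : s < b) : s < a ^ t * b ^ (1 - t) := by
  calc s = s ^ t * s ^ (1 - t) := by
        rw [← ENNReal.rpow_add_of_nonneg _ _ ht.le (by linarith)]; simp
    _ < _ := ENNReal.mul_lt_mul (ENNReal.rpow_lt_rpow ha ht)
        (ENNReal.rpow_lt_rpow hb (by linarith))

-- Both suprema being `1` makes the superlevel sets of `f` and `g` nonempty at every height `s < 1`.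
-- Since `t {f > s} + (1 - t) {g > s} ⊆ {h > s}`, one-dimensional Brunn–Minkowski and integration
-- over `s` give an inequality between arithmetic means, stronger than the geometric one.
open MeasureTheory Set in
theorem prekopa_leindler_normalized {t : ℝ} (ht : 0 < t) (ht1 : t < 1) {f g h : ℝ → ENNReal}
    (hf : Measurable f) (hg : Measurable g) (hh : Measurable h)
    (hf1 : ∀ x, f x ≤ 1) (hg1 : ∀ x, g x ≤ 1)
    (hf2 : ∀ s < 1, ∃ x, s < f x) (hg2 : ∀ s < 1, ∃ x, s < g x)
    (H : ∀ x y, f x ^ t * g y ^ (1 - t) ≤ h (t * x + (1 - t) * y)) :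
    (∫⁻ x, f x) ^ t * (∫⁻ x, g x) ^ (1 - t) ≤ ∫⁻ x, h x := by
  have hlin : ENNReal.ofReal t * (∫⁻ x, f x) + ENNReal.ofReal (1 - t) * (∫⁻ x, g x)
      ≤ ∫⁻ x, h x := by
    -- Truncating `h` at `1` loses nothing, because only heights `s < 1` enter.
    calc _ ≤ ∫⁻ x, min (h x) 1 := by
          rw [lintegral_eq_setLIntegral_Ioo_measure_lt _ hf hf1,
            lintegral_eq_setLIntegral_Ioo_measure_lt _ hg hg1,
            lintegral_eq_setLIntegral_Ioo_measure_lt _ (hh.min measurable_const)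
              (fun x => min_le_right _ _),
            ← lintegral_const_mul' _ _ ENNReal.ofReal_ne_top,
            ← lintegral_const_mul' _ _ ENNReal.ofReal_ne_top, ← lintegral_add_left]
          · refine setLIntegral_mono' measurableSet_Ioo fun s hs => ?_
            have hs1 : ENNReal.ofReal s < 1 := by
              rw [ENNReal.ofReal_lt_one]; exact hs.2
            rw [← volume_smul_real ht, ← volume_smul_real (by linarith : 0 < 1 - t)]
            obtain ⟨x, hx⟩ := hf2 _ hs1
            obtain ⟨y, hy⟩ := hg2 _ hs1
            refine volume_add_le_of_measurableSet ((hf measurableSet_Ioi).const_smul₀ t)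
              ((hg measurableSet_Ioi).const_smul₀ (1 - t)) ⟨_, smul_mem_smul_set hx⟩
              ⟨_, smul_mem_smul_set hy⟩ ?_
            rintro _ ⟨x, hx, rfl⟩ _ ⟨y, hy, rfl⟩
            simp only [smul_eq_mul, mem_ofPred_eq, lt_min_iff]
            exact ⟨(lt_rpow_mul_rpow_one_sub ht ht1 hx hy).trans_le (H x y), hs1⟩
          · refine Measurable.const_mul ?_ _
            refine Antitone.measurable fun a b hab => measure_mono fun x hx => ?_
            exact lt_of_le_of_lt (ENNReal.ofReal_le_ofReal hab) hx
      _ ≤ _ := lintegral_mono fun x => min_le_left _ _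
  refine le_trans ?_ hlin
  -- Weighted AM–GM is Young's inequality with exponents `1 / t` and `1 / (1 - t)`.
  have hc : (1 / t).HolderConjugate (1 / (1 - t)) := by
    rw [Real.holderConjugate_iff]
    refine ⟨by rw [lt_div_iff₀ ht]; linarith, ?_⟩
    simp
  have := ENNReal.young_inequality ((∫⁻ x, f x) ^ t) ((∫⁻ x, g x) ^ (1 - t)) hc
  have h1t : 1 - t ≠ 0 := by linarith
  rw [← ENNReal.rpow_mul, ← ENNReal.rpow_mul, mul_one_div_cancel ht.ne',
    mul_one_div_cancel h1t, ENNReal.rpow_one, ENNReal.rpow_one, ENNReal.div_eq_inv_mul,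
    ENNReal.div_eq_inv_mul, ← ENNReal.ofReal_inv_of_pos (by positivity),
    ← ENNReal.ofReal_inv_of_pos (one_div_pos.2 (by linarith)), one_div, one_div, inv_inv,
    inv_inv] at this
  exact this

open MeasureTheory Set in
theorem prekopa_leindler_bounded {t : ℝ} (ht : 0 < t) (ht1 : t < 1) {f g h : ℝ → ENNReal}
    (hf : Measurable f) (hg : Measurable g) (hh : Measurable h)
    (hf1 : ⨆ x, f x ≠ ⊤) (hg1 : ⨆ x, g x ≠ ⊤)
    (H : ∀ x y, f x ^ t * g y ^ (1 - t) ≤ h (t * x + (1 - t) * y)) :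
    (∫⁻ x, f x) ^ t * (∫⁻ x, g x) ^ (1 - t) ≤ ∫⁻ x, h x := by
  have ht1' : 0 < 1 - t := by linarith
  rcases eq_or_ne (⨆ x, f x) 0 with hf0 | hf0
  · have : ∀ x, f x = 0 := fun x => le_antisymm (hf0 ▸ le_iSup f x) bot_le
    simp [this, ht]
  rcases eq_or_ne (⨆ x, g x) 0 with hg0 | hg0
  · have : ∀ x, g x = 0 := fun x => le_antisymm (hg0 ▸ le_iSup g x) bot_le
    simp [this, ht1]
  set F := ⨆ x, f x
  set G := ⨆ x, g x
  have key := prekopa_leindler_normalized ht ht1 (f := fun x => F⁻¹ * f x)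
    (g := fun x => G⁻¹ * g x) (h := fun x => (F⁻¹ ^ t * G⁻¹ ^ (1 - t)) * h x)
    (hf.const_mul _) (hg.const_mul _) (hh.const_mul _)
    (fun x => by
      rw [mul_comm, ← div_eq_mul_inv]
      exact ENNReal.div_le_of_le_mul (by rw [one_mul]; exact le_iSup f x))
    (fun x => by
      rw [mul_comm, ← div_eq_mul_inv]
      exact ENNReal.div_le_of_le_mul (by rw [one_mul]; exact le_iSup g x))
    (fun s hs => by
      have : s * F < ⨆ x, f x := by
        calc s * F < 1 * F := (ENNReal.mul_lt_mul_iff_left hf0 hf1).2 hs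
          _ = _ := one_mul _
      obtain ⟨x, hx⟩ := lt_iSup_iff.1 this
      refine ⟨x, ?_⟩
      rw [mul_comm, ← div_eq_mul_inv]
      exact (ENNReal.lt_div_iff_mul_lt (Or.inl hf0) (Or.inl hf1)).2 hx)
    (fun s hs => by
      have : s * G < ⨆ x, g x := by
        calc s * G < 1 * G := (ENNReal.mul_lt_mul_iff_left hg0 hg1).2 hs
          _ = _ := one_mul _
      obtain ⟨x, hx⟩ := lt_iSup_iff.1 this
      refine ⟨x, ?_⟩
      rw [mul_comm, ← div_eq_mul_inv]
      exact (ENNReal.lt_div_iff_mul_lt (Or.inl hg0) (Or.inl hg1)).2 hx)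
    (fun x y => by
      rw [ENNReal.mul_rpow_of_nonneg _ _ ht.le, ENNReal.mul_rpow_of_nonneg _ _ ht1'.le,
        mul_mul_mul_comm]
      gcongr
      exact H x y)
  rw [lintegral_const_mul _ hf, lintegral_const_mul _ hg, lintegral_const_mul _ hh,
    ENNReal.mul_rpow_of_nonneg _ _ ht.le, ENNReal.mul_rpow_of_nonneg _ _ ht1'.le,
    mul_mul_mul_comm] at key
  refine (ENNReal.mul_le_mul_iff_right ?_ ?_).1 key
  · refine mul_ne_zero ?_ ?_
    · exact (ENNReal.rpow_pos (ENNReal.inv_pos.2 hf1) (ENNReal.inv_ne_top.2 hf0)).ne'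
    · exact (ENNReal.rpow_pos (ENNReal.inv_pos.2 hg1) (ENNReal.inv_ne_top.2 hg0)).ne'
  · exact ENNReal.mul_ne_top (ENNReal.rpow_ne_top_of_nonneg ht.le (ENNReal.inv_ne_top.2 hf0))
      (ENNReal.rpow_ne_top_of_nonneg ht1'.le (ENNReal.inv_ne_top.2 hg0))

open MeasureTheory Set Filter Topology in
theorem tendsto_lintegral_min_natCast {α : Type*} [MeasurableSpace α] {μ : Measure α}
    {f : α → ENNReal} (hf : Measurable f) :
    Tendsto (fun k : ℕ => ∫⁻ x, min (f x) k ∂μ) atTop (𝓝 (∫⁻ x, f x ∂μ)) := by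
  refine lintegral_tendsto_of_tendsto_of_monotone
    (fun k => (hf.min measurable_const).aemeasurable)
    (ae_of_all _ fun x a b hab => min_le_min le_rfl (by exact_mod_cast hab))
    (ae_of_all _ fun x => ?_)
  have : Tendsto (fun k : ℕ => min (f x) (k : ENNReal)) atTop (𝓝 (min (f x) ⊤)) :=
    (tendsto_const_nhds).min ENNReal.tendsto_nat_nhds_top
  simpa using this

open MeasureTheory Set Filter Topology in
/-- The Prékopa–Leindler inequality on the real line. -/
theorem prekopa_leindler_real {t : ℝ} (ht : 0 < t) (ht1 : t < 1) {f g h : ℝ → ENNReal}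
    (hf : Measurable f) (hg : Measurable g) (hh : Measurable h)
    (H : ∀ x y, f x ^ t * g y ^ (1 - t) ≤ h (t * x + (1 - t) * y)) :
    (∫⁻ x, f x) ^ t * (∫⁻ x, g x) ^ (1 - t) ≤ ∫⁻ x, h x := by
  have ht1' : 0 < 1 - t := by linarith
  rcases eq_or_ne (∫⁻ x, f x) 0 with hf0 | hf0
  · simp [hf0, ht]
  rcases eq_or_ne (∫⁻ x, g x) 0 with hg0 | hg0
  · simp [hg0, ht1]
  have hlim : Tendsto (fun k : ℕ => (∫⁻ x, min (f x) k) ^ t * (∫⁻ x, min (g x) k) ^ (1 - t)) atTop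
      (𝓝 ((∫⁻ x, f x) ^ t * (∫⁻ x, g x) ^ (1 - t))) := by
    refine ENNReal.Tendsto.mul
      ((ENNReal.continuous_rpow_const.tendsto _).comp (tendsto_lintegral_min_natCast hf)) (Or.inl ?_)
      ((ENNReal.continuous_rpow_const.tendsto _).comp (tendsto_lintegral_min_natCast hg)) (Or.inl ?_)
    · simp [hf0, not_lt.2 ht.le]
    · simp [hg0, not_lt.2 ht1.le]
  refine le_of_tendsto' hlim fun k => ?_
  refine prekopa_leindler_bounded ht ht1 (hf.min measurable_const) (hg.min measurable_const) hh
    ?_ ?_ ?_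
  · exact ((iSup_le fun x => min_le_right _ _).trans_lt (ENNReal.natCast_lt_top k)).ne
  · exact ((iSup_le fun x => min_le_right _ _).trans_lt (ENNReal.natCast_lt_top k)).ne
  · intro x y
    refine le_trans ?_ (H x y)
    gcongr <;> exact min_le_left _ _

open MeasureTheory Set in
theorem lintegral_pi_succ {n : ℕ} {f : (Fin (n + 1) → ℝ) → ENNReal} (hf : Measurable f) :
    ∫⁻ x, f x = ∫⁻ s : ℝ, ∫⁻ y : Fin n → ℝ, f (Fin.cons s y) := by
  have h1 := (volume_preserving_piFinSuccAbove (fun _ : Fin (n + 1) => ℝ) 0).symm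
  rw [← h1.lintegral_comp hf, Measure.volume_eq_prod]
  refine (lintegral_prod (μ := volume) (ν := volume) (fun p : ℝ × (Fin n → ℝ) =>
    f ((MeasurableEquiv.piFinSuccAbove (fun _ => ℝ) 0).symm p))
    (hf.comp (MeasurableEquiv.measurable _)).aemeasurable).trans ?_
  refine lintegral_congr fun s => lintegral_congr fun y => congrArg f ?_
  exact Fin.insertNth_zero' s y

open MeasureTheory Set in
/-- The Prékopa–Leindler inequality. -/
theorem prekopa_leindler_pi {t : ℝ} (ht : 0 < t) (ht1 : t < 1) (n : ℕ)
    {f g h : (Fin n → ℝ) → ENNReal}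
    (hf : Measurable f) (hg : Measurable g) (hh : Measurable h)
    (H : ∀ x y, f x ^ t * g y ^ (1 - t) ≤ h (t • x + (1 - t) • y)) :
    (∫⁻ x, f x) ^ t * (∫⁻ x, g x) ^ (1 - t) ≤ ∫⁻ x, h x := by
  induction n with
  | zero =>
    simp only [lintegral_unique, volume_pi, Measure.pi_univ, Finset.univ_eq_empty,
      Finset.prod_empty, mul_one]
    have := H default default
    rwa [Subsingleton.elim (t • default + (1 - t) • default) (default : Fin 0 → ℝ),
      Subsingleton.elim (default : Fin 0 → ℝ) Unique.instInhabited.default] at this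
  | succ n ih =>
    have hc : Measurable fun p : ℝ × (Fin n → ℝ) => (Fin.cons p.1 p.2 : Fin (n + 1) → ℝ) := by
      refine measurable_pi_lambda _ fun i => ?_
      refine Fin.cases ?_ (fun j => ?_) i
      · exact measurable_fst
      · exact (measurable_pi_apply j).comp measurable_snd
    rw [lintegral_pi_succ hf, lintegral_pi_succ hg, lintegral_pi_succ hh]
    -- The induction hypothesis on slices says exactly that the marginals in the first coordinate
    -- satisfy the one-dimensional hypothesis.
    refine prekopa_leindler_real ht ht1 (hf.comp hc).lintegral_prod_right'
      (hg.comp hc).lintegral_prod_right' (hh.comp hc).lintegral_prod_right' fun a b => ?_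
    refine ih (hf.comp (hc.comp measurable_prodMk_left)) (hg.comp (hc.comp measurable_prodMk_left))
      (hh.comp (hc.comp measurable_prodMk_left)) fun x y => ?_
    convert H (Fin.cons a x) (Fin.cons b y) using 2
    ext i
    refine Fin.cases ?_ (fun j => ?_) i <;> simp

open MeasureTheory Set in
theorem prekopa_leindler_euclideanSpace {t : ℝ} (ht : 0 < t) (ht1 : t < 1) {n : ℕ}
    {f g h : EuclideanSpace ℝ (Fin n) → ENNReal}
    (hf : Measurable f) (hg : Measurable g) (hh : Measurable h)
    (H : ∀ x y, f x ^ t * g y ^ (1 - t) ≤ h (t • x + (1 - t) • y)) :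
    (∫⁻ x, f x) ^ t * (∫⁻ x, g x) ^ (1 - t) ≤ ∫⁻ x, h x := by
  have h1 := PiLp.volume_preserving_toLp (Fin n)
  rw [← h1.lintegral_comp hf, ← h1.lintegral_comp hg, ← h1.lintegral_comp hh]
  exact prekopa_leindler_pi ht ht1 n (hf.comp h1.measurable) (hg.comp h1.measurable)
    (hh.comp h1.measurable) fun x y => H _ _

open MeasureTheory Set in
theorem isLogConcaveMeasure_withDensity {n : ℕ} {ρ : EuclideanSpace ℝ (Fin n) → ENNReal}
    (hρ : Measurable ρ)
    (H : ∀ t : ℝ, 0 < t → t < 1 → ∀ x y, ρ x ^ t * ρ y ^ (1 - t) ≤ ρ (t • x + (1 - t) • y)) :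
    IsLogConcaveMeasure (volume.withDensity ρ) := by
  intro A B hA hB _ _ t ht ht1
  have hC : MeasurableSet (t • A + (1 - t) • B) :=
    ((hA.smul t).add (hB.smul (1 - t))).measurableSet
  rw [withDensity_apply _ hA.measurableSet, withDensity_apply _ hB.measurableSet,
    withDensity_apply _ hC, ← lintegral_indicator hA.measurableSet,
    ← lintegral_indicator hB.measurableSet, ← lintegral_indicator hC]
  refine prekopa_leindler_euclideanSpace ht ht1 (hρ.indicator hA.measurableSet)
    (hρ.indicator hB.measurableSet) (hρ.indicator hC) fun x y => ?_
  by_cases hx : x ∈ A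
  · by_cases hy : y ∈ B
    · rw [indicator_of_mem hx, indicator_of_mem hy, indicator_of_mem
        (add_mem_add (smul_mem_smul_set hx) (smul_mem_smul_set hy))]
      exact H t ht ht1 x y
    · simp [hy, ht1]
  · simp [hx, ht]

/-! ### From a volume counterexample to a log-concave one. -/

-- The bathtub principle: `B` is a superlevel set of `f` at height `m`. After `A ∩ B` is cancelled,
-- `f ≤ m` on what remains of `A` and `f ≥ m` on what remains of `B`.
open MeasureTheory Set Topology in
theorem setLIntegral_le_of_measure_le {X : Type*} [MeasurableSpace X] {ν : Measure X}
    {f : X → ENNReal} {A B : Set X} (hA : MeasurableSet A)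
    (hB : MeasurableSet B) (m : ENNReal) (h1 : ∀ x ∈ B, m ≤ f x) (h2 : ∀ x ∉ B, f x ≤ m)
    (hAB : ν A ≤ ν B) (hfin : ν A ≠ ⊤) : ∫⁻ x in A, f x ∂ν ≤ ∫⁻ x in B, f x ∂ν := by
  have h3 : ν (A \ B) ≤ ν (B \ A) := by
    have e1 := measure_inter_add_sdiff A hB (μ := ν)
    have e2 := measure_inter_add_sdiff B hA (μ := ν)
    rw [inter_comm] at e2
    rw [← e1, ← e2] at hAB
    exact (ENNReal.add_le_add_iff_left (ne_top_of_le_ne_top hfin (measure_mono inter_subset_left))).1 hAB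
  calc ∫⁻ x in A, f x ∂ν = ∫⁻ x in A ∩ B, f x ∂ν + ∫⁻ x in A \ B, f x ∂ν :=
        (lintegral_inter_add_sdiff f A hB).symm
    _ ≤ ∫⁻ x in A ∩ B, f x ∂ν + m * ν (A \ B) := by
        gcongr
        calc ∫⁻ x in A \ B, f x ∂ν ≤ ∫⁻ x in A \ B, m ∂ν :=
              setLIntegral_mono' (MeasurableSet.diff hA hB) fun x hx => h2 x hx.2
          _ = _ := by simp
    _ ≤ ∫⁻ x in B ∩ A, f x ∂ν + m * ν (B \ A) := by rw [inter_comm]; gcongr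
    _ ≤ ∫⁻ x in B ∩ A, f x ∂ν + ∫⁻ x in B \ A, f x ∂ν := by
        gcongr
        calc m * ν (B \ A) = ∫⁻ x in B \ A, m ∂ν := by simp
          _ ≤ _ := setLIntegral_mono' (MeasurableSet.diff hB hA) fun x hx => h1 x hx.1
    _ = _ := lintegral_inter_add_sdiff f B hA

section Body

variable {n : ℕ} {K L : Set (EuclideanSpace ℝ (Fin n))}

theorem IsSymmConvexBody.mem_nhds_zero (hL : IsSymmConvexBody L) :
    L ∈ nhds (0 : EuclideanSpace ℝ (Fin n)) := by
  obtain ⟨x, hx⟩ := hL.interior_nonempty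
  have hx' : -x ∈ interior L := by
    rw [hL.symm, mem_interior_iff_mem_nhds]
    have : L ∈ nhds (- -x) := by rw [neg_neg]; exact mem_interior_iff_mem_nhds.1 hx
    exact continuous_neg.continuousAt.preimage_mem_nhds this
  rw [← mem_interior_iff_mem_nhds]
  have := hL.convex.interior hx hx' (a := 1 / 2) (b := 1 / 2) (by norm_num) (by norm_num)
    (by norm_num)
  simpa using this

theorem IsSymmConvexBody.gauge_le_iff (hL : IsSymmConvexBody L) {r : ℝ} (hr : 0 < r)
    (x : EuclideanSpace ℝ (Fin n)) : gauge L x ≤ r ↔ x ∈ r • L := by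
  rw [Set.mem_smul_set_iff_inv_smul_mem₀ hr.ne', ← hL.isCompact.isClosed.closure_eq,
    ← gauge_le_one_iff_mem_closure hL.convex hL.mem_nhds_zero, hL.isCompact.isClosed.closure_eq,
    gauge_smul_of_nonneg (by positivity), smul_eq_mul, inv_mul_le_iff₀ hr, mul_one]

open MeasureTheory in
theorem integrable_exp_neg_mul_norm {c : ℝ} (hc : 0 < c) :
    Integrable (fun x : EuclideanSpace ℝ (Fin n) => Real.exp (-(c * ‖x‖))) := by
  have h := (integrable_one_add_norm (E := EuclideanSpace ℝ (Fin n)) (μ := volume)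
    (r := (n + 1 : ℕ)) (by simp)).const_mul (Real.exp c * (n + 1).factorial / c ^ (n + 1))
  refine h.mono' (by fun_prop) (ae_of_all _ fun x => ?_)
  have hx : 0 < 1 + ‖x‖ := by positivity
  rw [Real.norm_of_nonneg (Real.exp_pos _).le, Real.rpow_neg hx.le, Real.rpow_natCast]
  have h1 := Real.pow_div_factorial_le_exp (c * (1 + ‖x‖)) (by positivity) (n + 1)
  have h2 : Real.exp (c * (1 + ‖x‖)) = Real.exp c * Real.exp (c * ‖x‖) := by
    rw [← Real.exp_add]; ring_nf
  rw [h2, mul_pow] at h1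
  rw [Real.exp_neg, ← div_eq_mul_inv, div_div, le_div_iff₀ (by positivity),
    inv_mul_le_iff₀ (by positivity)]
  rw [div_le_iff₀ (by positivity)] at h1
  linarith

open MeasureTheory in
theorem IsSymmConvexBody.lintegral_exp_neg_gauge_lt_top (hL : IsSymmConvexBody L) {ε : ℝ}
    (hε : 0 < ε) :
    ∫⁻ x, ENNReal.ofReal (Real.exp (-(ε * gauge L x))) < ⊤ := by
  obtain ⟨R, hR0, hR⟩ := hL.isCompact.isBounded.subset_closedBall_lt 0 0
  have hle : ∀ x, ‖x‖ / R ≤ gauge L x := fun x =>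
    le_gauge_of_subset_closedBall (absorbent_nhds_zero hL.mem_nhds_zero) hR0.le hR
  refine lt_of_le_of_lt (lintegral_mono fun x => ENNReal.ofReal_le_ofReal
    (Real.exp_le_exp.2 (?_ : _ ≤ -(ε / R * ‖x‖)))) ?_
  · rw [neg_le_neg_iff]
    calc ε / R * ‖x‖ = ε * (‖x‖ / R) := by ring
      _ ≤ _ := by gcongr; exact hle x
  · exact (integrable_exp_neg_mul_norm (by positivity)).lintegral_lt_top

-- The additive constant in `φ` will be the logarithm of this integral, so the bound keeps `φ`
-- nonnegative.
open MeasureTheory Filter Topology in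
theorem IsSymmConvexBody.exists_lintegral_exp_neg_gauge_ge (hL : IsSymmConvexBody L) (hn : n ≠ 0) :
    ∃ ε₀ > 0, ∀ ε, 0 < ε → ε ≤ ε₀ → 1 ≤ ∫⁻ x, ENNReal.ofReal (Real.exp (-(ε * gauge L x))) := by
  have hpos : 0 < volume L :=
    lt_of_lt_of_le (isOpen_interior.measure_pos _ hL.interior_nonempty)
      (measure_mono interior_subset)
  have hfin : volume L ≠ ⊤ := hL.isCompact.measure_lt_top.ne
  have hposr : 0 < (volume L).toReal := ENNReal.toReal_pos hpos.ne' hfin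
  obtain ⟨R, hR0, hR⟩ : ∃ R : ℝ, 0 < R ∧ 1 ≤ Real.exp (-1) * (R ^ n * (volume L).toReal) := by
    have h1 : Tendsto (fun R : ℝ => Real.exp (-1) * (R ^ n * (volume L).toReal)) atTop atTop :=
      ((tendsto_pow_atTop hn).atTop_mul_const hposr).const_mul_atTop (Real.exp_pos _)
    obtain ⟨R, h2, h3⟩ := ((eventually_gt_atTop 0).and (h1.eventually_ge_atTop 1)).exists
    exact ⟨R, h2, h3⟩
  refine ⟨1 / R, by positivity, fun ε hε hεR => ?_⟩
  calc (1 : ENNReal) ≤ ENNReal.ofReal (Real.exp (-1) * (R ^ n * (volume L).toReal)) := by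
        rw [← ENNReal.ofReal_one]; exact ENNReal.ofReal_le_ofReal hR
    _ = ENNReal.ofReal (Real.exp (-1)) * volume (R • L) := by
        rw [Measure.addHaar_smul, ENNReal.ofReal_mul (Real.exp_pos _).le,
          ENNReal.ofReal_mul (by positivity), ENNReal.ofReal_toReal hfin,
          abs_of_pos (by positivity), finrank_euclideanSpace_fin]
    _ = ∫⁻ x in R • L, ENNReal.ofReal (Real.exp (-1)) := by simp
    _ ≤ ∫⁻ x in R • L, ENNReal.ofReal (Real.exp (-(ε * gauge L x))) := by
        refine setLIntegral_mono' (hL.isCompact.smul R).measurableSet fun x hx => ?_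
        refine ENNReal.ofReal_le_ofReal (Real.exp_le_exp.2 ?_)
        rw [neg_le_neg_iff]
        calc ε * gauge L x ≤ 1 / R * R := by
              gcongr
              · exact gauge_nonneg x
              · exact (hL.gauge_le_iff hR0 x).2 hx
          _ = 1 := by field_simp
    _ ≤ _ := setLIntegral_le_lintegral _ _

open MeasureTheory in
theorem normDensity_rpow_mul_le (hL : IsSymmConvexBody L) {ε c : ℝ} (hε : 0 ≤ ε) (t : ℝ)
    (ht : 0 < t) (ht1 : t < 1) (x y : EuclideanSpace ℝ (Fin n)) :
    normDensity (fun s => ε * s + c) L x ^ t * normDensity (fun s => ε * s + c) L y ^ (1 - t)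
      ≤ normDensity (fun s => ε * s + c) L (t • x + (1 - t) • y) := by
  unfold normDensity
  rw [ENNReal.ofReal_rpow_of_pos (Real.exp_pos _), ENNReal.ofReal_rpow_of_pos (Real.exp_pos _),
    ← ENNReal.ofReal_mul (by positivity), ← Real.exp_mul, ← Real.exp_mul, ← Real.exp_add]
  refine ENNReal.ofReal_le_ofReal (Real.exp_le_exp.2 ?_)
  have h1 := gauge_add_le hL.convex (absorbent_nhds_zero hL.mem_nhds_zero) (t • x) ((1 - t) • y)
  rw [gauge_smul_of_nonneg ht.le, gauge_smul_of_nonneg (by linarith)] at h1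
  simp only [smul_eq_mul] at h1
  nlinarith [mul_le_mul_of_nonneg_left h1 hε]

open MeasureTheory in
theorem sectionMeasure_smul_le (hK : IsSymmConvexBody K) (hL : IsSymmConvexBody L) {ε c : ℝ}
    (hε : 0 ≤ ε) (F : Submodule ℝ (EuclideanSpace ℝ (Fin n))) (ν : Measure F)
    [ν.IsAddHaarMeasure]
    (h : ν {x | (x : EuclideanSpace ℝ (Fin n)) ∈ K} ≤ ν {x | (x : EuclideanSpace ℝ (Fin n)) ∈ L})
    {r : ℝ} (hr : 0 < r) :
    ∫⁻ x in {x : F | (x : EuclideanSpace ℝ (Fin n)) ∈ r • K},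
      normDensity (fun s => ε * s + c) L x ∂ν
      ≤ ∫⁻ x in {x : F | (x : EuclideanSpace ℝ (Fin n)) ∈ r • L},
        normDensity (fun s => ε * s + c) L x ∂ν := by
  have hs : ∀ A : Set (EuclideanSpace ℝ (Fin n)),
      {x : F | (x : EuclideanSpace ℝ (Fin n)) ∈ r • A} = r • {x : F | (x : EuclideanSpace ℝ (Fin n)) ∈ A} := by
    intro A
    ext x
    simp only [Set.mem_ofPred_eq, Set.mem_smul_set_iff_inv_smul_mem₀ hr.ne', Submodule.coe_smul]
  have hc : ∀ A : Set (EuclideanSpace ℝ (Fin n)), IsCompact A →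
      IsCompact {x : F | (x : EuclideanSpace ℝ (Fin n)) ∈ A} := fun A hA =>
    (F.closed_of_finiteDimensional.isClosedEmbedding_subtypeVal).isCompact_preimage hA
  refine setLIntegral_le_of_measure_le (hc _ (hK.isCompact.smul r)).measurableSet
    (hc _ (hL.isCompact.smul r)).measurableSet (ENNReal.ofReal (Real.exp (-(ε * r + c)))) ?_ ?_ ?_
    (hc _ (hK.isCompact.smul r)).measure_lt_top.ne
  · intro x hx
    have hx := (hL.gauge_le_iff hr _).2 hx
    unfold normDensity
    beta_reduce
    gcongr
  · intro x hx
    have hx : r ≤ gauge L (x : EuclideanSpace ℝ (Fin n)) :=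
      (not_le.1 (mt (hL.gauge_le_iff hr _).1 hx)).le
    unfold normDensity
    beta_reduce
    gcongr
  · rw [hs, hs, Measure.addHaar_smul, Measure.addHaar_smul]
    gcongr

open MeasureTheory in
theorem exists_logConcave_of_section_le (hn : n ≠ 0) (hK : IsSymmConvexBody K)
    (hL : IsSymmConvexBody L)
    (hsec : ∀ ξ : EuclideanSpace ℝ (Fin n), ‖ξ‖ = 1 →
      (@volume (Submodule.span ℝ {ξ})ᗮ measureSpaceOfInnerProductSpace)
        {x | (x : EuclideanSpace ℝ (Fin n)) ∈ K} ≤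
      (@volume (Submodule.span ℝ {ξ})ᗮ measureSpaceOfInnerProductSpace)
        {x | (x : EuclideanSpace ℝ (Fin n)) ∈ L})
    (hvol : volume L < volume K) :
    ∃ (φ : ℝ → ℝ) (μ : Measure (EuclideanSpace ℝ (Fin n))),
      (∀ s, 0 ≤ s → 0 ≤ φ s) ∧ StrictMonoOn φ (Set.Ici 0) ∧ ConvexOn ℝ (Set.Ici 0) φ ∧
      μ = volume.withDensity (normDensity φ L) ∧
      IsProbabilityMeasure μ ∧ IsLogConcaveMeasure μ ∧
      (∀ ξ : EuclideanSpace ℝ (Fin n), ‖ξ‖ = 1 → ∀ r : ℝ, 0 < r →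
        sectionMeasure (normDensity φ L) (r • K) ξ ≤ sectionMeasure (normDensity φ L) (r • L) ξ) ∧
      μ L < μ K := by
  have hcont : Continuous (gauge L) := continuous_gauge hL.convex hL.mem_nhds_zero
  obtain ⟨ε₀, hε₀, hge⟩ := hL.exists_lintegral_exp_neg_gauge_ge hn
  obtain ⟨M, hM⟩ := hK.isCompact.bddAbove_image hcont.continuousOn
  have hKfin : volume K ≠ ⊤ := hK.isCompact.measure_lt_top.ne
  have hLfin : volume L ≠ ⊤ := hL.isCompact.measure_lt_top.ne
  have hvol' : (volume L).toReal < (volume K).toReal := (ENNReal.toReal_lt_toReal hLfin hKfin).2 hvol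
  -- Before normalization, `L` has mass at most `volume L`, and `K` at least `exp (-(ε * M)) *
  -- volume K`, as `M` bounds the gauge of `L` on `K`.
  obtain ⟨ε, ⟨hε1, hε2⟩, hε3⟩ : ∃ ε : ℝ, (0 < ε ∧ ε ≤ ε₀) ∧
      (volume L).toReal < Real.exp (-(ε * M)) * (volume K).toReal := by
    have hc : Continuous fun ε : ℝ => Real.exp (-(ε * M)) * (volume K).toReal := by fun_prop
    have h1 : ∀ᶠ ε in nhdsWithin (0 : ℝ) (Set.Ioi 0),
        (volume L).toReal < Real.exp (-(ε * M)) * (volume K).toReal :=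
      (hc.tendsto' 0 ((volume K).toReal) (by simp) |>.mono_left
        nhdsWithin_le_nhds).eventually_const_lt hvol'
    have h2 : ∀ᶠ ε in nhdsWithin (0 : ℝ) (Set.Ioi 0), ε ∈ Set.Ioc 0 ε₀ := Ioc_mem_nhdsGT hε₀
    exact (h2.and h1).exists
  set I := ∫⁻ x, ENNReal.ofReal (Real.exp (-(ε * gauge L x))) with hI
  have hI1 : 1 ≤ I := hge ε hε1 hε2
  have hItop : I ≠ ⊤ := (hL.lintegral_exp_neg_gauge_lt_top hε1).ne
  have hIr : 1 ≤ I.toReal := by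
    rw [← ENNReal.toReal_one]; exact ENNReal.toReal_mono hItop hI1
  set c := Real.log I.toReal with hc
  have hc0 : 0 ≤ c := Real.log_nonneg hIr
  have hdens : ∀ x, normDensity (fun s => ε * s + c) L x
      = I⁻¹ * ENNReal.ofReal (Real.exp (-(ε * gauge L x))) := by
    intro x
    unfold normDensity
    rw [neg_add, add_comm, Real.exp_add, ENNReal.ofReal_mul (Real.exp_pos _).le, Real.exp_neg,
      Real.exp_log (by linarith), ENNReal.ofReal_inv_of_pos (by linarith),
      ENNReal.ofReal_toReal hItop]
  have hmeas : Measurable fun x => ENNReal.ofReal (Real.exp (-(ε * gauge L x))) := by fun_prop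
  have hmeas' : Measurable (normDensity (fun s => ε * s + c) L) := by
    rw [funext hdens]; exact hmeas.const_mul _
  have hI0 : I⁻¹ ≠ 0 := ENNReal.inv_ne_zero.2 hItop
  have hIt : I⁻¹ ≠ ⊤ := ENNReal.inv_ne_top.2 (by positivity)
  have happ : ∀ A, MeasurableSet A → (volume.withDensity (normDensity (fun s => ε * s + c) L)) A
      = I⁻¹ * ∫⁻ x in A, ENNReal.ofReal (Real.exp (-(ε * gauge L x))) := by
    intro A hA
    rw [withDensity_apply _ hA, funext hdens, lintegral_const_mul _ hmeas]
  refine ⟨fun s => ε * s + c, _, fun s hs => by positivity, ?_, ?_, rfl, ⟨?_⟩, ?_, ?_, ?_⟩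
  · intro a _ b _ hab
    simp only
    gcongr
  · refine ⟨convex_Ici 0, fun x _ y _ a b _ _ hab => le_of_eq ?_⟩
    simp only [smul_eq_mul]
    linear_combination (-c) * hab
  · rw [happ _ MeasurableSet.univ, setLIntegral_univ, ← hI]
    exact ENNReal.inv_mul_cancel (by positivity) hItop
  · exact isLogConcaveMeasure_withDensity hmeas' (normDensity_rpow_mul_le hL hε1.le)
  · intro ξ hξ r hr
    exact sectionMeasure_smul_le hK hL hε1.le _ _ (hsec ξ hξ) hr
  · rw [happ _ hL.isCompact.measurableSet, happ _ hK.isCompact.measurableSet]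
    refine (ENNReal.mul_lt_mul_iff_right hI0 hIt).2 ?_
    calc ∫⁻ x in L, ENNReal.ofReal (Real.exp (-(ε * gauge L x)))
        ≤ ∫⁻ x in L, 1 := by
          refine lintegral_mono fun x => ?_
          rw [ENNReal.ofReal_le_one, Real.exp_le_one_iff, neg_nonpos]
          exact mul_nonneg hε1.le (gauge_nonneg x)
      _ = ENNReal.ofReal (volume L).toReal := by simp [ENNReal.ofReal_toReal hLfin]
      _ < ENNReal.ofReal (Real.exp (-(ε * M)) * (volume K).toReal) :=
          (ENNReal.ofReal_lt_ofReal_iff (lt_of_le_of_lt ENNReal.toReal_nonneg hε3)).2 hε3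
      _ = ∫⁻ x in K, ENNReal.ofReal (Real.exp (-(ε * M))) := by
          rw [ENNReal.ofReal_mul (Real.exp_pos _).le, ENNReal.ofReal_toReal hKfin]; simp
      _ ≤ _ := by
          refine setLIntegral_mono' hK.isCompact.measurableSet fun x hx => ?_
          have : gauge L x ≤ M := hM (Set.mem_image_of_mem _ hx)
          gcongr

end Body

/-! ### Polar coordinates and homogeneous integrands. -/

section Polar

open MeasureTheory Set Metric Module

variable {F : Type*} [NormedAddCommGroup F] [NormedSpace ℝ F] [FiniteDimensional ℝ F]
  [MeasurableSpace F] [BorelSpace F] (μ : Measure F) [μ.IsAddHaarMeasure]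

/-- Integration in polar coordinates. -/
theorem lintegral_polar [Nontrivial F] {f : F → ENNReal} (hf : Measurable f) :
    ∫⁻ x, f x ∂μ = ∫⁻ θ : sphere (0 : F) 1, (∫⁻ r in Ioi (0 : ℝ),
      ENNReal.ofReal (r ^ (finrank ℝ F - 1)) * f (r • (θ : F))) ∂μ.toSphere := by
  have h1 : ∫⁻ x, f x ∂μ = ∫⁻ x : ({0}ᶜ : Set F), f x ∂(μ.comap (↑)) := by
    rw [lintegral_subtype_comap (measurableSet_singleton _).compl, restrict_compl_singleton]
  have h2 : Measurable fun p : sphere (0 : F) 1 × Ioi (0 : ℝ) => f (p.2.1 • (p.1 : F)) :=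
    hf.comp ((measurable_subtype_coe.comp measurable_snd).smul
      (measurable_subtype_coe.comp measurable_fst))
  have h3 := (μ.measurePreserving_homeomorphUnitSphereProd).lintegral_comp h2
  rw [h1]
  calc ∫⁻ x : ({0}ᶜ : Set F), f x ∂(μ.comap (↑))
      = ∫⁻ x : ({0}ᶜ : Set F), f ((homeomorphUnitSphereProd F x).2.1 •
          ((homeomorphUnitSphereProd F x).1 : F)) ∂(μ.comap (↑)) := by
        refine lintegral_congr fun x => ?_
        have hx : ‖(x : F)‖ ≠ 0 := norm_ne_zero_iff.2 x.2
        simp [smul_smul, hx]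
    _ = _ := h3
    _ = _ := by
        rw [lintegral_prod _ h2.aemeasurable]
        refine lintegral_congr fun θ => ?_
        have h4 : Measurable fun r : Ioi (0 : ℝ) => f (r.1 • (θ : F)) :=
          h2.comp measurable_prodMk_left
        rw [Measure.volumeIoiPow]
        refine (lintegral_withDensity_eq_lintegral_mul _ (by fun_prop) h4).trans ?_
        exact lintegral_subtype_comap measurableSet_Ioi
          (fun r : ℝ => ENNReal.ofReal (r ^ (finrank ℝ F - 1)) * f (r • (θ : F)))

theorem setLIntegral_Ioc_pow {R : ℝ} (hR : 0 ≤ R) (k : ℕ) :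
    ∫⁻ r in Ioc 0 R, ENNReal.ofReal (r ^ k) = ENNReal.ofReal (R ^ (k + 1) / (k + 1)) := by
  rw [← ofReal_integral_eq_lintegral_ofReal (intervalIntegral.intervalIntegrable_pow _).1,
    ← intervalIntegral.integral_of_le hR]
  · simp
  · filter_upwards [ae_restrict_mem measurableSet_Ioc] with y hy
    exact pow_nonneg hy.1.le _

/-- The volume of the unit ball of a positive 2-homogeneous function, as a spherical integral. -/
theorem measureReal_sublevel_eq_integral_sphere [Nontrivial F] {Q : F → ℝ} (hQ : Measurable Q)
    (hpos : ∀ x, x ≠ 0 → 0 < Q x) (hom : ∀ (r : ℝ) x, Q (r • x) = r ^ 2 * Q x) :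
    μ.real {x | Q x ≤ 1} = (finrank ℝ F : ℝ)⁻¹ *
      ∫ θ : sphere (0 : F) 1, Q θ ^ (-(finrank ℝ F : ℝ) / 2) ∂μ.toSphere := by
  set d := finrank ℝ F with hd
  have hd0 : d ≠ 0 := finrank_pos.ne'
  have hms : MeasurableSet {x | Q x ≤ 1} := hQ measurableSet_Iic
  have h1 : μ {x | Q x ≤ 1} = ∫⁻ θ : sphere (0 : F) 1,
      ENNReal.ofReal ((d : ℝ)⁻¹ * Q θ ^ (-(d : ℝ) / 2)) ∂μ.toSphere := by
    rw [← lintegral_indicator_one hms, lintegral_polar μ (measurable_one.indicator hms)]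
    refine lintegral_congr fun θ => ?_
    have hθ : 0 < Q θ := hpos _ (ne_zero_of_mem_unit_sphere θ)
    -- `R` is the radial function of `{Q ≤ 1}` in the direction `θ`.
    set R := Q θ ^ (-(1 : ℝ) / 2) with hR
    have hR0 : 0 < R := Real.rpow_pos_of_pos hθ _
    have hR2 : R ^ 2 * Q θ = 1 := by
      rw [hR, ← Real.rpow_natCast, ← Real.rpow_mul hθ.le]
      norm_num
      rw [Real.rpow_neg_one, inv_mul_cancel₀ hθ.ne']
    have hRd : R ^ d = Q θ ^ (-(d : ℝ) / 2) := by
      rw [hR, ← Real.rpow_natCast, ← Real.rpow_mul hθ.le]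
      congr 1; ring
    have h2 : ∀ r ∈ Ioi (0 : ℝ), ENNReal.ofReal (r ^ (d - 1)) *
        {x | Q x ≤ 1}.indicator 1 (r • (θ : F))
        = (Ioc 0 R).indicator (fun r => ENNReal.ofReal (r ^ (d - 1))) r := by
      intro r hr
      have hiff : r • (θ : F) ∈ {x | Q x ≤ 1} ↔ r ∈ Ioc 0 R := by
        have h3 : r ^ 2 * Q θ ≤ 1 ↔ r ≤ R := by
          rw [← sq_le_sq₀ (le_of_lt hr) hR0.le, ← mul_le_mul_iff_left₀ (b := r ^ 2) hθ, hR2]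
        rw [mem_ofPred_eq, hom, h3]
        exact ⟨fun h => ⟨hr, h⟩, fun h => h.2⟩
      by_cases h : r • (θ : F) ∈ {x | Q x ≤ 1}
      · rw [indicator_of_mem h, indicator_of_mem (hiff.1 h)]; simp
      · rw [indicator_of_notMem h, indicator_of_notMem (mt hiff.2 h)]; simp
    rw [setLIntegral_congr_fun measurableSet_Ioi h2, lintegral_indicator measurableSet_Ioc,
      Measure.restrict_restrict measurableSet_Ioc, inter_eq_left.2 (fun r hr => hr.1),
      setLIntegral_Ioc_pow hR0.le, Nat.sub_add_cancel (Nat.one_le_iff_ne_zero.2 hd0), hRd,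
      div_eq_inv_mul]
    congr 3
    exact_mod_cast Nat.sub_add_cancel (Nat.one_le_iff_ne_zero.2 hd0)
  rw [Measure.real, h1, ← integral_const_mul, integral_eq_lintegral_of_nonneg_ae]
  · refine ae_of_all _ fun θ => ?_
    have hθ : 0 < Q θ := hpos _ (ne_zero_of_mem_unit_sphere θ)
    positivity
  · refine Measurable.aestronglyMeasurable ?_
    exact ((hQ.comp measurable_subtype_coe).pow_const _).const_mul _

theorem setLIntegral_Icc_inv {a : ℝ} (ha : 0 < a) :
    ∫⁻ r in Icc a (2 * a), ENNReal.ofReal r⁻¹ = ENNReal.ofReal (Real.log 2) := by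
  have h0 : (0 : ℝ) ∉ uIcc a (2 * a) := by
    rw [uIcc_of_le (by linarith)]; exact fun h => absurd h.1 (not_le.2 ha)
  rw [setLIntegral_congr Ioc_ae_eq_Icc.symm, ← ofReal_integral_eq_lintegral_ofReal,
    ← intervalIntegral.integral_of_le (by linarith), integral_inv h0, mul_div_cancel_right₀ _ ha.ne']
  · exact (intervalIntegrable_iff_integrableOn_Ioc_of_le (by linarith)).1
      (intervalIntegral.intervalIntegrable_inv (fun x hx => by
        rintro rfl; exact h0 hx) continuousOn_id)
  · filter_upwards [ae_restrict_mem measurableSet_Ioc] with y hy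
    exact inv_nonneg.2 (ha.trans hy.1).le

/-- Integrals over a shell of a function homogeneous of degree `-dim F` are multiples of
integrals over the sphere, independently of the shell. -/
theorem setLIntegral_shell_eq [Nontrivial F] {u : F → ENNReal} (hu : Measurable u)
    (hom : ∀ r : ℝ, 0 < r → ∀ x, ENNReal.ofReal (r ^ finrank ℝ F) * u (r • x) = u x)
    {ρ : F → ℝ} (hρ : Measurable ρ) (hρ0 : ∀ x, 0 ≤ ρ x)
    (hρh : ∀ r : ℝ, 0 < r → ∀ x, ρ (r • x) = r * ρ x)
    (hρn : ∀ᵐ θ : sphere (0 : F) 1 ∂μ.toSphere, ρ θ ≠ 0) :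
    ∫⁻ x in {x | ρ x ∈ Icc 1 2}, u x ∂μ
      = ENNReal.ofReal (Real.log 2) * ∫⁻ θ : sphere (0 : F) 1, u θ ∂μ.toSphere := by
  set d := finrank ℝ F with hd
  have hd0 : d ≠ 0 := finrank_pos.ne'
  have hms : MeasurableSet {x | ρ x ∈ Icc (1 : ℝ) 2} := hρ measurableSet_Icc
  rw [← lintegral_indicator hms, lintegral_polar μ (hu.indicator hms),
    ← lintegral_const_mul' _ _ ENNReal.ofReal_ne_top]
  refine lintegral_congr_ae ?_
  filter_upwards [hρn] with θ hθ
  have hθ' : 0 < ρ θ := (hρ0 _).lt_of_ne' hθ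
  -- On each ray the integrand becomes `u θ / r`, and the integral of `1 / r` from `a` to `2 * a` is
  -- `log 2` whatever `a` is.
  have h2 : ∀ r ∈ Ioi (0 : ℝ), ENNReal.ofReal (r ^ (d - 1)) *
      {x | ρ x ∈ Icc (1 : ℝ) 2}.indicator u (r • (θ : F))
      = (Icc (ρ θ)⁻¹ (2 * (ρ θ)⁻¹)).indicator (fun r => ENNReal.ofReal r⁻¹ * u θ) r := by
    intro r (hr : 0 < r)
    have hiff : r • (θ : F) ∈ {x | ρ x ∈ Icc (1 : ℝ) 2} ↔ r ∈ Icc (ρ θ)⁻¹ (2 * (ρ θ)⁻¹) := by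
      rw [mem_ofPred_eq, hρh r hr, mem_Icc, mem_Icc, inv_le_iff_one_le_mul₀ hθ',
        ← div_eq_mul_inv, le_div_iff₀ hθ']
    by_cases h : r • (θ : F) ∈ {x | ρ x ∈ Icc (1 : ℝ) 2}
    · rw [indicator_of_mem h, indicator_of_mem (hiff.1 h), ← hom r hr θ, ← mul_assoc,
        ← ENNReal.ofReal_mul (inv_pos.2 hr).le]
      congr 2
      obtain ⟨k, hk⟩ := Nat.exists_eq_succ_of_ne_zero hd0
      rw [hk]; simp only [Nat.succ_eq_add_one, Nat.add_sub_cancel]; field_simp; ring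
    · rw [indicator_of_notMem h, indicator_of_notMem (mt hiff.2 h), mul_zero]
  rw [setLIntegral_congr_fun measurableSet_Ioi h2, lintegral_indicator measurableSet_Icc,
    Measure.restrict_restrict measurableSet_Icc,
    inter_eq_left.2 (fun r hr => mem_Ioi.2 ((inv_pos.2 hθ').trans_le hr.1)),
    lintegral_mul_const _ (by fun_prop), setLIntegral_Icc_inv (inv_pos.2 hθ')]

theorem ae_toSphere_notMem_submodule [Nontrivial F] {V : Submodule ℝ F} (hV : V ≠ ⊤) :
    ∀ᵐ θ : sphere (0 : F) 1 ∂μ.toSphere, (θ : F) ∉ V := by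
  have hm : MeasurableSet {θ : sphere (0 : F) 1 | (θ : F) ∈ V} :=
    (V.closed_of_finiteDimensional.preimage continuous_subtype_val).measurableSet
  rw [ae_iff]
  simp only [not_not]
  rw [Measure.toSphere_apply' _ hm, mul_eq_zero]
  right
  refine measure_mono_null ?_ (Measure.addHaar_submodule μ V hV)
  rintro _ ⟨r, _, _, ⟨θ, hθ, rfl⟩, rfl⟩
  exact V.smul_mem r hθ

end Polar

/-! ### Ellipsoid weights and their sections. -/

theorem integral_mul_add_mul_sub {X : Type*} [MeasurableSpace X] {μ : MeasureTheory.Measure X}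
    {f g h : X → ℝ} (hf : MeasureTheory.Integrable f μ) (hg : MeasureTheory.Integrable g μ)
    (hh : MeasureTheory.Integrable h μ) (a b : ℝ) :
    ∫ x, (a * f x + b * g x - h x) ∂μ = a * ∫ x, f x ∂μ + b * ∫ x, g x ∂μ - ∫ x, h x ∂μ := by
  have h1 := (hf.const_mul a).add (hg.const_mul b)
  rw [← MeasureTheory.integral_const_mul, ← MeasureTheory.integral_const_mul,
    ← MeasureTheory.integral_add (hf.const_mul a) (hg.const_mul b)]
  exact MeasureTheory.integral_sub h1 hh

section Ellipsoid

open MeasureTheory Set Metric Module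

variable {F : Type*} [NormedAddCommGroup F] [InnerProductSpace ℝ F]

/-- The quadratic form `|x|² + (β⁻¹ - 1) ⟨e, x⟩²`. For a unit vector `e`, its unit ball is an
ellipsoid of revolution with semiaxis `√β` along `e` and all other semiaxes equal to `1`. -/
noncomputable def ellForm (e : F) (β : ℝ) (x : F) : ℝ := ‖x‖ ^ 2 + (β⁻¹ - 1) * inner ℝ e x ^ 2

/-- The radial function of the unit ball of `ellForm e β` to the power `p`, normalized. -/
noncomputable def ellWeight (e : F) (p β : ℝ) (x : F) : ℝ :=
  β ^ (-(1 : ℝ) / 2) * ellForm e β x ^ (-p / 2)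

/-- A signed combination of ellipsoid weights with nonnegative integral over every central
hyperplane section of the sphere. -/
noncomputable def signedWeight (e : F) (p β : ℝ) (x : F) : ℝ :=
  (1 - β) * ellWeight e p β x + β * ellWeight e p 1 x - ellWeight e p (2 * β - β ^ 2) x

theorem ellForm_smul (e : F) (β r : ℝ) (x : F) : ellForm e β (r • x) = r ^ 2 * ellForm e β x := by
  simp only [ellForm, norm_smul, inner_smul_right, mul_pow, Real.norm_eq_abs, sq_abs]
  ring

theorem continuous_ellForm (e : F) (β : ℝ) : Continuous (ellForm e β) := by
  unfold ellForm; fun_prop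

theorem ellForm_pos {e : F} (he : ‖e‖ ≤ 1) {β : ℝ} (hβ : 0 < β) {x : F} (hx : x ≠ 0) :
    0 < ellForm e β x := by
  have hx' : 0 < ‖x‖ := norm_pos_iff.2 hx
  have h1 : inner ℝ e x ^ 2 ≤ ‖x‖ ^ 2 := by
    rw [← sq_abs]
    gcongr
    calc |inner ℝ e x| ≤ ‖e‖ * ‖x‖ := abs_real_inner_le_norm e x
      _ ≤ 1 * ‖x‖ := by gcongr
      _ = _ := one_mul _
  have hβ' : 0 < β⁻¹ := inv_pos.2 hβ
  unfold ellForm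
  rcases le_or_gt (inner ℝ e x ^ 2) 0 with h | h
  · have : inner ℝ e x ^ 2 = 0 := le_antisymm h (sq_nonneg _)
    rw [this, mul_zero, add_zero]; positivity
  · nlinarith [mul_pos hβ' h]

theorem continuous_sphere_ellWeight {e : F} (he : ‖e‖ ≤ 1) (p : ℝ) {β : ℝ} (hβ : 0 < β) :
    Continuous fun θ : sphere (0 : F) 1 => ellWeight e p β θ := by
  unfold ellWeight
  refine continuous_const.mul (((continuous_ellForm e β).comp continuous_subtype_val).rpow_const
    fun θ => Or.inl (ellForm_pos he hβ (ne_zero_of_mem_unit_sphere θ)).ne')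

theorem continuous_sphere_signedWeight {e : F} (he : ‖e‖ ≤ 1) (p : ℝ) {β : ℝ} (hβ : 0 < β)
    (hβ1 : β < 1) :
    Continuous fun θ : sphere (0 : F) 1 => signedWeight e p β θ := by
  have h3 : 0 < 2 * β - β ^ 2 := by nlinarith
  unfold signedWeight
  exact ((continuous_const.mul (continuous_sphere_ellWeight he p hβ)).add
    (continuous_const.mul (continuous_sphere_ellWeight he p one_pos))).sub
    (continuous_sphere_ellWeight he p h3)

theorem one_add_ellForm_coeff_pos {s β : ℝ} (hs : 0 ≤ s) (hs1 : s ≤ 1) (hβ : 0 < β) :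
    0 < 1 + (β⁻¹ - 1) * s := by
  have hβ' : 0 < β⁻¹ := inv_pos.2 hβ
  rcases hs.eq_or_lt with rfl | h
  · simp
  · nlinarith [mul_pos hβ' h]

variable [FiniteDimensional ℝ F] [MeasurableSpace F] [BorelSpace F] (μ : Measure F)
  [μ.IsAddHaarMeasure]

/-- The ellipsoid is the preimage of the unit ball under the transvection `x ↦ x + k * ⟨e, x⟩ • e`.
Vectors shorter than `1` are allowed because `e` will be the projection of a unit vector to a
hyperplane. -/
theorem measureReal_ellForm_le_one {e : F} (he : ‖e‖ ≤ 1) {β : ℝ} (hβ : 0 < β) :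
    μ.real {x | ellForm e β x ≤ 1}
      = (1 + (β⁻¹ - 1) * ‖e‖ ^ 2) ^ (-(1 : ℝ) / 2) * μ.real (closedBall 0 1) := by
  set s := ‖e‖ ^ 2 with hs
  have hs0 : 0 ≤ s := sq_nonneg _
  have hs1 : s ≤ 1 := by rw [hs]; exact pow_le_one₀ (norm_nonneg _) he
  have hpos := one_add_ellForm_coeff_pos hs0 hs1 hβ
  set c := β⁻¹ - 1 with hc
  -- `k` solves `(1 + k * s) ^ 2 = 1 + c * s`. The factor `s` is kept in the second equation so that
  -- `e = 0` is covered.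
  obtain ⟨k, hk1, hk2⟩ : ∃ k : ℝ, 1 + k * s = (1 + c * s) ^ ((1 : ℝ) / 2) ∧
      (2 * k + k ^ 2 * s) * s = c * s := by
    rcases eq_or_ne s 0 with h0 | h0
    · exact ⟨0, by simp [h0], by simp [h0]⟩
    · refine ⟨((1 + c * s) ^ ((1 : ℝ) / 2) - 1) / s, by field_simp; ring, ?_⟩
      have : ((1 + c * s) ^ ((1 : ℝ) / 2)) ^ 2 = 1 + c * s := by
        rw [← Real.rpow_natCast, ← Real.rpow_mul hpos.le]; norm_num
      field_simp
      linear_combination this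
  set f : Dual ℝ F := k • (innerSL ℝ e : F →ₗ[ℝ] ℝ) with hf
  have hfx : ∀ x, f x = k * inner ℝ e x := fun x => by simp [hf]
  have hdet : LinearMap.det (LinearMap.transvection f e) = (1 + c * s) ^ ((1 : ℝ) / 2) := by
    rw [LinearMap.transvection.det, hfx, real_inner_self_eq_norm_sq, ← hk1]
  have hdet0 : 0 < (1 + c * s) ^ ((1 : ℝ) / 2) := Real.rpow_pos_of_pos hpos _
  have hset : {x | ellForm e β x ≤ 1} = (LinearMap.transvection f e) ⁻¹' closedBall 0 1 := by
    ext x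
    have hn : ‖LinearMap.transvection f e x‖ ^ 2 = ellForm e β x := by
      rw [LinearMap.transvection.apply, hfx, ← real_inner_self_eq_norm_sq, ellForm]
      simp only [inner_add_left, inner_add_right, inner_smul_left, inner_smul_right,
        real_inner_self_eq_norm_sq, ← hc, ← hs, real_inner_comm e x]
      simp only [map_mul, RCLike.conj_to_real]
      rcases eq_or_ne s 0 with h0 | h0
      · have he0 : e = 0 := by simpa [hs] using h0
        simp [he0]
      · have hk3 : 2 * k + k ^ 2 * s = c := mul_right_cancel₀ h0 hk2
        linear_combination (inner ℝ e x ^ 2) * hk3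
    rw [mem_ofPred_eq, mem_preimage, mem_closedBall_zero_iff, ← hn, sq_le_one_iff₀ (norm_nonneg _)]
  rw [hset, Measure.real, Measure.addHaar_preimage_linearMap _ (by rw [hdet]; exact hdet0.ne'),
    hdet, ENNReal.toReal_mul, ENNReal.toReal_ofReal (abs_nonneg _), abs_inv, abs_of_pos hdet0,
    ← Real.rpow_neg hpos.le, neg_div]
  rfl

theorem integral_sphere_ellWeight [Nontrivial F] {e : F} (he : ‖e‖ ≤ 1) {β : ℝ} (hβ : 0 < β) :
    ∫ θ : sphere (0 : F) 1, ellWeight e (finrank ℝ F) β θ ∂μ.toSphere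
      = (finrank ℝ F * μ.real (closedBall 0 1)) *
        (β * (1 - ‖e‖ ^ 2) + 1 * ‖e‖ ^ 2) ^ (-(1 : ℝ) / 2) := by
  have h := measureReal_sublevel_eq_integral_sphere μ (continuous_ellForm e β).measurable
    (fun x hx => ellForm_pos he hβ hx) (ellForm_smul e β)
  have hd : (finrank ℝ F : ℝ) ≠ 0 := by exact_mod_cast finrank_pos.ne'
  have hs1 : ‖e‖ ^ 2 ≤ 1 := pow_le_one₀ (norm_nonneg _) he
  have hpos := one_add_ellForm_coeff_pos (sq_nonneg ‖e‖) hs1 hβ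
  rw [measureReal_ellForm_le_one μ he hβ, eq_inv_mul_iff_mul_eq₀ hd] at h
  unfold ellWeight
  rw [integral_const_mul, ← h]
  have : β * (1 - ‖e‖ ^ 2) + 1 * ‖e‖ ^ 2 = β * (1 + (β⁻¹ - 1) * ‖e‖ ^ 2) := by
    field_simp; ring
  rw [this, Real.mul_rpow hβ.le hpos.le]
  ring

theorem rpow_neg_half_convex {x y a b : ℝ} (hx : 0 < x) (hy : 0 < y) (ha : 0 ≤ a) (hb : 0 ≤ b)
    (hab : a + b = 1) :
    (a * x + b * y) ^ (-(1 : ℝ) / 2) ≤ a * x ^ (-(1 : ℝ) / 2) + b * y ^ (-(1 : ℝ) / 2) := by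
  have hs : ∀ z : ℝ, 0 < z → z ^ (-(1 : ℝ) / 2) = (√z)⁻¹ := fun z hz => by
    rw [neg_div, Real.rpow_neg hz.le, Real.sqrt_eq_rpow]
  have hz : 0 < a * x + b * y := convex_Ioi (0 : ℝ) hx hy ha hb hab
  have hx' := Real.sqrt_pos.2 hx
  have hy' := Real.sqrt_pos.2 hy
  rw [hs _ hz, hs _ hx, hs _ hy]
  have hz' : 0 < a * √x + b * √y := convex_Ioi (0 : ℝ) hx' hy' ha hb hab
  have h1 : a * √x + b * √y ≤ √(a * x + b * y) :=
    Real.strictConcaveOn_sqrt.concaveOn.2 hx.le hy.le ha hb hab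
  refine (inv_anti₀ hz' h1).trans ?_
  have := (convexOn_zpow (𝕜 := ℝ) (-1)).2 hx' hy' ha hb hab
  simpa using this

theorem integrable_sphere_of_continuous {f : sphere (0 : F) 1 → ℝ} (hf : Continuous f) :
    Integrable f μ.toSphere :=
  hf.integrable_of_hasCompactSupport (HasCompactSupport.of_compactSpace f)

/-- Jensen for `z ↦ z ^ (-1 / 2)`: the parameter `2 * β - β ^ 2` is the mean of `β` and `1` with
weights `1 - β` and `β`, and the section formula is this power of an affine function of the
parameter. -/
theorem integral_sphere_signedWeight_nonneg [Nontrivial F] {e : F} (he : ‖e‖ ≤ 1) {β : ℝ}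
    (hβ : 0 < β) (hβ1 : β < 1) :
    0 ≤ ∫ θ : sphere (0 : F) 1, signedWeight e (finrank ℝ F) β θ ∂μ.toSphere := by
  have h3 : 0 < 2 * β - β ^ 2 := by nlinarith
  set d : ℝ := (finrank ℝ F : ℝ)
  have i1 := integrable_sphere_of_continuous μ (continuous_sphere_ellWeight he d hβ)
  have i2 := integrable_sphere_of_continuous μ (continuous_sphere_ellWeight he d one_pos)
  have i3 := integrable_sphere_of_continuous μ (continuous_sphere_ellWeight he d h3)
  have hs1 : ‖e‖ ^ 2 ≤ 1 := pow_le_one₀ (norm_nonneg _) he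
  unfold signedWeight
  rw [integral_mul_add_mul_sub i1 i2 i3,
    integral_sphere_ellWeight μ he hβ, integral_sphere_ellWeight μ he one_pos,
    integral_sphere_ellWeight μ he h3]
  have hp : ∀ b : ℝ, 0 < b → 0 < b * (1 - ‖e‖ ^ 2) + 1 * ‖e‖ ^ 2 := fun b hb => by
    rcases hs1.eq_or_lt with h | h
    · rw [h]; norm_num
    · have := mul_pos hb (sub_pos.2 h)
      positivity
  have key := rpow_neg_half_convex (hp β hβ) (hp 1 one_pos) (sub_nonneg.2 hβ1.le) hβ.le (by ring)
  have e1 : (1 - β) * (β * (1 - ‖e‖ ^ 2) + 1 * ‖e‖ ^ 2) + β * (1 * (1 - ‖e‖ ^ 2) + 1 * ‖e‖ ^ 2)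
      = (2 * β - β ^ 2) * (1 - ‖e‖ ^ 2) + 1 * ‖e‖ ^ 2 := by ring
  rw [e1] at key
  have hC : 0 ≤ d * μ.real (closedBall (0 : F) 1) := by positivity
  nlinarith [mul_le_mul_of_nonneg_left key hC]

end Ellipsoid

section Restrict

open MeasureTheory Set Metric Module

variable {E : Type*} [NormedAddCommGroup E] [InnerProductSpace ℝ E]

/-- Restriction to a subspace stays in the family, with `e` replaced by its projection. Hence one
formula serves all hyperplanes. -/
theorem ellForm_coe (V : Submodule ℝ E) [V.HasOrthogonalProjection] (e : E) (β : ℝ) (x : V) :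
    ellForm e β (x : E) = ellForm (V.orthogonalProjectionOnto e) β x := by
  unfold ellForm
  rw [Submodule.inner_orthogonalProjectionOnto_eq_of_mem_right]
  rfl

theorem signedWeight_coe (V : Submodule ℝ E) [V.HasOrthogonalProjection] (e : E) (p β : ℝ) (x : V) :
    signedWeight e p β (x : E) = signedWeight (V.orthogonalProjectionOnto e) p β x := by
  simp only [signedWeight, ellWeight, ellForm_coe]

end Restrict

/-! ### The one-dimensional integral and its failure of convexity. -/

section Profile

open MeasureTheory Set Filter Topology

/-- The integrand describing, up to a constant, the integral of `ellWeight` against the radial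
function of the unit ball of `baseForm`. -/
noncomputable def profile (p β s : ℝ) : ℝ :=
  (1 + β ^ 2 * s ^ 4) ^ (-(1 : ℝ) / 4) * (1 + s ^ 2) ^ (-p / 2)

theorem continuous_profile (p β : ℝ) : Continuous (profile p β) := by
  unfold profile
  refine Continuous.mul ?_ ?_
  · exact (by fun_prop : Continuous fun s : ℝ => 1 + β ^ 2 * s ^ 4).rpow_const
      fun s => Or.inl (by positivity)
  · exact (by fun_prop : Continuous fun s : ℝ => 1 + s ^ 2).rpow_const
      fun s => Or.inl (by positivity)

theorem profile_pos (p β s : ℝ) : 0 < profile p β s := by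
  unfold profile; positivity

theorem profile_le (p β s : ℝ) : profile p β s ≤ profile p 0 s := by
  unfold profile
  gcongr ?_ * _
  refine Real.rpow_le_rpow_of_nonpos (by positivity) ?_ (by norm_num)
  have : 0 ≤ β ^ 2 * s ^ 4 := by positivity
  linarith

theorem integrable_profile {p : ℝ} (hp : 1 < p) (β : ℝ) : Integrable (profile p β) := by
  have h : Integrable (profile p 0) := by
    have := integrable_rpow_neg_one_add_norm_sq (E := ℝ) (μ := volume) (r := p) (by simpa using hp)
    have e : profile p 0 = fun s => (1 + ‖s‖ ^ 2) ^ (-p / 2) := by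
      funext s; simp [profile]
    rwa [e]
  refine h.mono' (continuous_profile p β).aestronglyMeasurable (ae_of_all _ fun s => ?_)
  rw [Real.norm_of_nonneg (profile_pos p β s).le]
  exact profile_le p β s

/-- The exponent `5 / 4` is chosen greater than `1`, so that the bound is `o(β)`, and less than `3 /
2`, so that `q ^ (5 / 4 - p / 2)` with `q = 1 + s ^ 2` is integrable for every `p ≥ 4`. This is
where the dimension bound enters. -/
theorem profile_zero_sub_le {p : ℝ} (hp : 4 ≤ p) {β : ℝ} (hβ : 0 < β) (s : ℝ) :
    profile p 0 s - profile p β s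
      ≤ β ^ ((5 : ℝ) / 4) * (1 + ‖s‖ ^ 2) ^ (-(3 / 2 : ℝ) / 2) := by
  set q := 1 + s ^ 2 with hq
  have hq1 : 1 ≤ q := by nlinarith [sq_nonneg s]
  have hq0 : 0 < q := by linarith
  set x := β ^ 2 * s ^ 4 with hx
  have hx0 : 0 ≤ x := by positivity
  have hz : 0 < β * q := by positivity
  have hxz : x ≤ (β * q) ^ 2 := by
    rw [hx, mul_pow]
    gcongr
    rw [hq]; nlinarith [sq_nonneg s]
  have h1 : 1 - (1 + x) ^ (-(1 : ℝ) / 4) ≤ (β * q) ^ ((5 : ℝ) / 4) := by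
    rcases le_or_gt (β * q) 1 with h | h
    · have h2 : (1 + x) ^ (-(1 : ℝ)) ≤ (1 + x) ^ (-(1 : ℝ) / 4) :=
        Real.rpow_le_rpow_of_exponent_le (by linarith) (by norm_num)
      have h3 : 1 - x ≤ (1 + x) ^ (-(1 : ℝ)) := by
        rw [Real.rpow_neg_one, ← one_div, le_div_iff₀ (by linarith)]
        nlinarith
      have h4 : (β * q) ^ 2 ≤ (β * q) ^ ((5 : ℝ) / 4) := by
        rw [← Real.rpow_natCast]
        exact Real.rpow_le_rpow_of_exponent_ge hz h (by norm_num)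
      linarith
    · have h2 : 0 < (1 + x) ^ (-(1 : ℝ) / 4) := by positivity
      have h3 : 1 ≤ (β * q) ^ ((5 : ℝ) / 4) := Real.one_le_rpow h.le (by norm_num)
      linarith
  have h2 : profile p 0 s - profile p β s = (1 - (1 + x) ^ (-(1 : ℝ) / 4)) * q ^ (-p / 2) := by
    simp only [profile, ← hx, ← hq]
    norm_num
    ring
  rw [h2, Real.norm_eq_abs, sq_abs, ← hq]
  calc _ ≤ (β * q) ^ ((5 : ℝ) / 4) * q ^ (-(2 : ℝ)) := by
        gcongr
        linarith
    _ = _ := by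
        rw [Real.mul_rpow hβ.le hq0.le, mul_assoc, ← Real.rpow_add hq0]
        norm_num

/-- With `D β` the drop of the integral from its value at `0`, the expression is `D (2β - β²) - (1 -
β) * D β - β * D 1`. The first term is `O(β ^ (5 / 4))`, so the fixed positive `D 1` wins for small
`β`. -/
theorem exists_profile_integral_neg {p : ℝ} (hp : 4 ≤ p) :
    ∃ β : ℝ, 0 < β ∧ β < 1 ∧ (1 - β) * (∫ s, profile p β s) + β * (∫ s, profile p 1 s)
      - ∫ s, profile p (2 * β - β ^ 2) s < 0 := by
  have hint : ∀ β, Integrable (profile p β) := integrable_profile (by linarith)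
  set D : ℝ → ℝ := fun β => ∫ s, (profile p 0 s - profile p β s) with hD
  have hDeq : ∀ β, ∫ s, profile p β s = (∫ s, profile p 0 s) - D β := fun β => by
    rw [hD]
    simp only
    rw [integral_sub (hint 0) (hint β)]; ring
  have hD0 : ∀ β, 0 ≤ D β := fun β =>
    integral_nonneg fun s => sub_nonneg.2 (profile_le p β s)
  have hD1 : 0 < D 1 := by
    refine integral_pos_of_integrable_nonneg_nonzero
      ((continuous_profile p 0).sub (continuous_profile p 1)) (x := 1) ((hint 0).sub (hint 1)) (fun s => sub_nonneg.2 (profile_le p 1 s)) ?_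
    have h1 : ((1 : ℝ) + 1) ^ (-(1 : ℝ) / 4) < 1 :=
      Real.rpow_lt_one_of_one_lt_of_neg (by norm_num) (by norm_num)
    have h2 : (0 : ℝ) < (1 + 1) ^ (-p / 2) := by positivity
    have : profile p 0 1 - profile p 1 1 = (1 - (1 + 1) ^ (-(1 : ℝ) / 4)) * (1 + 1) ^ (-p / 2) := by
      simp only [profile]; norm_num; ring
    rw [this]
    exact (mul_pos (by linarith) h2).ne'
  set C := ∫ s : ℝ, (1 + ‖s‖ ^ 2) ^ (-(3 / 2 : ℝ) / 2) with hC
  have hCint : Integrable fun s : ℝ => (1 + ‖s‖ ^ 2) ^ (-(3 / 2 : ℝ) / 2) :=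
    integrable_rpow_neg_one_add_norm_sq (by simp; norm_num)
  have hDle : ∀ β, 0 < β → D β ≤ β ^ ((5 : ℝ) / 4) * C := fun β hβ => by
    rw [hC, ← integral_const_mul]
    exact integral_mono ((hint 0).sub (hint β)) (hCint.const_mul _) fun s =>
      profile_zero_sub_le hp hβ s
  have hC0 : 0 ≤ C := integral_nonneg fun s => by positivity
  obtain ⟨β, ⟨hβ0, hβ1⟩, hβ⟩ : ∃ β ∈ Ioo (0 : ℝ) 1,
      (2 : ℝ) ^ ((5 : ℝ) / 4) * β ^ ((1 : ℝ) / 4) * C < D 1 := by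
    have hc : Continuous fun β : ℝ => (2 : ℝ) ^ ((5 : ℝ) / 4) * β ^ ((1 : ℝ) / 4) * C := by
      have := Real.continuous_rpow_const (q := (1 : ℝ) / 4) (by norm_num)
      fun_prop
    have h1 : ∀ᶠ β in 𝓝[>] (0 : ℝ), (2 : ℝ) ^ ((5 : ℝ) / 4) * β ^ ((1 : ℝ) / 4) * C < D 1 :=
      ((hc.tendsto' 0 0 (by norm_num)).mono_left nhdsWithin_le_nhds).eventually_lt_const hD1
    have h2 : ∀ᶠ β in 𝓝[>] (0 : ℝ), β ∈ Ioo (0 : ℝ) 1 := Ioo_mem_nhdsGT one_pos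
    exact (h2.and h1).exists
  refine ⟨β, hβ0, hβ1, ?_⟩
  have hβ' : 0 < 2 * β - β ^ 2 := by nlinarith
  have h3 : D (2 * β - β ^ 2) < β * D 1 := by
    calc D (2 * β - β ^ 2) ≤ (2 * β - β ^ 2) ^ ((5 : ℝ) / 4) * C := hDle _ hβ'
      _ ≤ (2 * β) ^ ((5 : ℝ) / 4) * C := by
          gcongr
          nlinarith [sq_nonneg β]
      _ = β * ((2 : ℝ) ^ ((5 : ℝ) / 4) * β ^ ((1 : ℝ) / 4) * C) := by
          rw [Real.mul_rpow (by norm_num) hβ0.le]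
          have : β ^ ((5 : ℝ) / 4) = β * β ^ ((1 : ℝ) / 4) := by
            rw [← Real.rpow_one_add' hβ0.le (by norm_num)]; norm_num
          rw [this]; ring
      _ < β * D 1 := by gcongr
  rw [hDeq, hDeq 1, hDeq (2 * β - β ^ 2)]
  nlinarith [mul_nonneg (sub_nonneg.2 hβ1.le) (hD0 β)]

theorem lintegral_eq_ofReal_mul_lintegral_comp_mul {c : ℝ} (hc : 0 < c) {f : ℝ → ENNReal}
    (hf : Measurable f) : ∫⁻ t, f t = ENNReal.ofReal c * ∫⁻ s, f (c * s) := by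
  conv_lhs => rw [← Real.smul_map_volume_mul_left hc.ne']
  rw [lintegral_smul_measure, lintegral_map hf (measurable_const_mul c), abs_of_pos hc, smul_eq_mul]

end Profile

/-! ### Reduction of the spherical integral to the profile. -/

section Slab

open MeasureTheory Set Metric Module

/-- With `t = ⟨e, x⟩` and `a = |x|² - t²`, the square of the norm `(a² + t⁴)^(1/4)`. -/
noncomputable def baseForm {E : Type*} [NormedAddCommGroup E] [InnerProductSpace ℝ E] (e x : E) : ℝ :=
  √((‖x‖ ^ 2 - inner ℝ e x ^ 2) ^ 2 + inner ℝ e x ^ 4)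

theorem continuous_baseForm {E : Type*} [NormedAddCommGroup E] [InnerProductSpace ℝ E] (e : E) :
    Continuous (baseForm e) := by
  unfold baseForm; fun_prop

theorem baseForm_pos {E : Type*} [NormedAddCommGroup E] [InnerProductSpace ℝ E] (e : E) {x : E}
    (hx : x ≠ 0) : 0 < baseForm e x := by
  have hx' : 0 < ‖x‖ := norm_pos_iff.2 hx
  refine Real.sqrt_pos.2 ?_
  rcases eq_or_ne (inner ℝ e x) 0 with h | h
  · rw [h, show (‖x‖ ^ 2 - 0 ^ 2) ^ 2 + 0 ^ 4 = ‖x‖ ^ 4 by ring]; positivity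
  · positivity

theorem baseForm_smul {E : Type*} [NormedAddCommGroup E] [InnerProductSpace ℝ E] (e : E) (r : ℝ)
    (x : E) : baseForm e (r • x) = r ^ 2 * baseForm e x := by
  unfold baseForm
  rw [norm_smul, inner_smul_right, mul_pow, Real.norm_eq_abs, sq_abs,
    show (r ^ 2 * ‖x‖ ^ 2 - (r * inner ℝ e x) ^ 2) ^ 2 + (r * inner ℝ e x) ^ 4
      = (r ^ 2) ^ 2 * ((‖x‖ ^ 2 - inner ℝ e x ^ 2) ^ 2 + inner ℝ e x ^ 4) by ring,
    Real.sqrt_mul (by positivity), Real.sqrt_sq (by positivity)]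

/-- Substitute `t = √(β * a) * s`. The power `β ^ (-1 / 2)` in the weight cancels the Jacobian's
dependence on `β`. -/
theorem lintegral_slice {a β : ℝ} (ha : 0 < a) (hβ : 0 < β) (p : ℝ) :
    ∫⁻ t : ℝ, ENNReal.ofReal ((√(a ^ 2 + t ^ 4)) ^ (-(1 : ℝ) / 2) *
      (β ^ (-(1 : ℝ) / 2) * (a + β⁻¹ * t ^ 2) ^ (-p / 2)))
      = ENNReal.ofReal (a ^ (-p / 2)) * ∫⁻ s, ENNReal.ofReal (profile p β s) := by
  have hc : 0 < √(β * a) := Real.sqrt_pos.2 (by positivity)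
  rw [lintegral_eq_ofReal_mul_lintegral_comp_mul hc (by fun_prop),
    ← lintegral_const_mul' _ _ ENNReal.ofReal_ne_top,
    ← lintegral_const_mul' _ _ ENNReal.ofReal_ne_top]
  refine lintegral_congr fun s => ?_
  rw [← ENNReal.ofReal_mul hc.le, ← ENNReal.ofReal_mul (by positivity)]
  congr 1
  have hc2 : √(β * a) ^ 2 = β * a := Real.sq_sqrt (by positivity)
  have h1 : a ^ 2 + (√(β * a) * s) ^ 4 = a ^ 2 * (1 + β ^ 2 * s ^ 4) := by
    rw [mul_pow, show √(β * a) ^ 4 = (√(β * a) ^ 2) ^ 2 by ring, hc2]; ring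
  have h2 : a + β⁻¹ * (√(β * a) * s) ^ 2 = a * (1 + s ^ 2) := by
    rw [mul_pow, hc2]; field_simp
  have hw : 0 < 1 + β ^ 2 * s ^ 4 := by positivity
  rw [h1, h2, Real.sqrt_mul (sq_nonneg a), Real.sqrt_sq ha.le, Real.mul_rpow ha.le (by positivity),
    Real.mul_rpow ha.le (by positivity), Real.sqrt_mul hβ.le, Real.sqrt_eq_rpow, Real.sqrt_eq_rpow,
    Real.sqrt_eq_rpow, ← Real.rpow_mul hw.le, profile]
  have e1 : β ^ ((1 : ℝ) / 2) * β ^ (-(1 : ℝ) / 2) = 1 := by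
    rw [← Real.rpow_add hβ]; norm_num
  have e2 : a ^ ((1 : ℝ) / 2) * a ^ (-(1 : ℝ) / 2) = 1 := by
    rw [← Real.rpow_add ha]; norm_num
  have e3 : (1 : ℝ) / 2 * (-1 / 2) = -1 / 4 := by norm_num
  rw [e3]
  linear_combination ((1 + β ^ 2 * s ^ 4) ^ (-(1 : ℝ) / 4) * a ^ (-p / 2) * (1 + s ^ 2) ^ (-p / 2)) *
    (a ^ ((1 : ℝ) / 2) * a ^ (-(1 : ℝ) / 2) * e1 + e2)

theorem inner_single_zero_toLp_cons {p : ℕ} (s : ℝ) (y : Fin p → ℝ) :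
    inner ℝ (EuclideanSpace.single (0 : Fin (p + 1)) (1 : ℝ))
      (WithLp.toLp 2 (Fin.cons s y : Fin (p + 1) → ℝ)) = s := by
  rw [EuclideanSpace.inner_single_left]; simp

theorem norm_sq_toLp_cons {p : ℕ} (s : ℝ) (y : Fin p → ℝ) :
    ‖(WithLp.toLp 2 (Fin.cons s y : Fin (p + 1) → ℝ) : EuclideanSpace ℝ (Fin (p + 1)))‖ ^ 2
      = s ^ 2 + ∑ i, y i ^ 2 := by
  rw [EuclideanSpace.real_norm_sq_eq, Fin.sum_univ_succ]; simp

theorem lintegral_euclideanSpace_succ {p : ℕ} {G : EuclideanSpace ℝ (Fin (p + 1)) → ENNReal}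
    (hG : Measurable G) :
    ∫⁻ x, G x = ∫⁻ y : Fin p → ℝ, ∫⁻ s : ℝ, G (WithLp.toLp 2 (Fin.cons s y)) := by
  have h1 := PiLp.volume_preserving_toLp (Fin (p + 1))
  have hc : Measurable fun q : ℝ × (Fin p → ℝ) => (Fin.cons q.1 q.2 : Fin (p + 1) → ℝ) := by
    refine measurable_pi_lambda _ fun i => ?_
    refine Fin.cases ?_ (fun j => ?_) i
    · exact measurable_fst
    · exact (measurable_pi_apply j).comp measurable_snd
  rw [← h1.lintegral_comp hG]
  refine (lintegral_pi_succ (hG.comp h1.measurable)).trans ?_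
  exact lintegral_lintegral_swap ((hG.comp h1.measurable).comp hc).aemeasurable

theorem setLIntegral_slab {p : ℕ} {β : ℝ} (hβ : 0 < β) :
    let e : EuclideanSpace ℝ (Fin (p + 1)) := EuclideanSpace.single 0 1
    ∫⁻ x in {x | √(‖x‖ ^ 2 - inner ℝ e x ^ 2) ∈ Icc 1 2},
      ENNReal.ofReal (baseForm e x ^ (-(1 : ℝ) / 2) * ellWeight e p β x)
      = (∫⁻ y : Fin p → ℝ in {y | √(∑ i, y i ^ 2) ∈ Icc 1 2},
          ENNReal.ofReal ((∑ i, y i ^ 2) ^ (-(p : ℝ) / 2))) *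
        ∫⁻ s, ENNReal.ofReal (profile p β s) := by
  intro e
  have hm : Measurable fun x : EuclideanSpace ℝ (Fin (p + 1)) =>
      ENNReal.ofReal (baseForm e x ^ (-(1 : ℝ) / 2) * ellWeight e p β x) := by
    have h1 := (continuous_baseForm e).measurable
    have h2 := (continuous_ellForm e β).measurable
    unfold ellWeight
    fun_prop
  have hs : MeasurableSet {x : EuclideanSpace ℝ (Fin (p + 1)) |
      √(‖x‖ ^ 2 - inner ℝ e x ^ 2) ∈ Icc (1 : ℝ) 2} :=
    (by fun_prop : Measurable fun x : EuclideanSpace ℝ (Fin (p + 1)) =>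
      √(‖x‖ ^ 2 - inner ℝ e x ^ 2)) measurableSet_Icc
  have hs' : MeasurableSet {y : Fin p → ℝ | √(∑ i, y i ^ 2) ∈ Icc (1 : ℝ) 2} :=
    (by fun_prop : Measurable fun y : Fin p → ℝ => √(∑ i, y i ^ 2)) measurableSet_Icc
  rw [← lintegral_indicator hs, lintegral_euclideanSpace_succ (hm.indicator hs),
    ← lintegral_mul_const _ (by fun_prop), ← lintegral_indicator hs']
  refine lintegral_congr fun y => ?_
  set a := ∑ i, y i ^ 2 with ha
  have hsub : ∀ s : ℝ, ‖(WithLp.toLp 2 (Fin.cons s y : Fin (p + 1) → ℝ) :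
      EuclideanSpace ℝ (Fin (p + 1)))‖ ^ 2 - inner ℝ e (WithLp.toLp 2 (Fin.cons s y)) ^ 2 = a := by
    intro s
    rw [norm_sq_toLp_cons, inner_single_zero_toLp_cons]; ring
  by_cases hy : √a ∈ Icc (1 : ℝ) 2
  · rw [indicator_of_mem (by exact hy)]
    have ha0 : 0 < a := Real.sqrt_pos.1 (one_pos.trans_le hy.1)
    rw [← lintegral_slice ha0 hβ]
    refine lintegral_congr fun s => ?_
    rw [indicator_of_mem (by rw [mem_ofPred_eq, hsub]; exact hy)]
    simp only [baseForm, ellWeight, ellForm, inner_single_zero_toLp_cons, e,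
      norm_sq_toLp_cons]
    simp only [e, inner_single_zero_toLp_cons, norm_sq_toLp_cons] at hsub
    rw [← ha, show s ^ 2 + a + (β⁻¹ - 1) * s ^ 2 = a + β⁻¹ * s ^ 2 by ring,
      show s ^ 2 + a - s ^ 2 = a by ring]
  · rw [indicator_of_notMem (by exact hy)]
    refine (lintegral_congr fun s => ?_).trans lintegral_zero
    rw [indicator_of_notMem (by rw [mem_ofPred_eq, hsub]; exact hy)]

/-- The integrand is homogeneous of degree `-(p + 1)`, minus the dimension, so up to `log 2` its
spherical integral equals its integral over the cylindrical shell `1 ≤ √a ≤ 2`. There the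
integration along the axis separates. -/
theorem exists_integral_sphere_eq_profile {p : ℕ} (hp : 2 ≤ p) :
    let e : EuclideanSpace ℝ (Fin (p + 1)) := EuclideanSpace.single 0 1
    ∃ A : ℝ, 0 < A ∧ ∀ β : ℝ, 0 < β →
      ∫ θ : sphere (0 : EuclideanSpace ℝ (Fin (p + 1))) 1,
        baseForm e θ ^ (-(1 : ℝ) / 2) * ellWeight e p β θ ∂(volume.toSphere)
        = A * ∫ s, profile p β s := by
  intro e
  have he : ‖e‖ = 1 := by simp [e]
  set C := ∫⁻ y : Fin p → ℝ in {y | √(∑ i, y i ^ 2) ∈ Icc 1 2},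
          ENNReal.ofReal ((∑ i, y i ^ 2) ^ (-(p : ℝ) / 2)) with hC
  have hcont : ∀ β, 0 < β → Continuous fun θ : sphere (0 : EuclideanSpace ℝ (Fin (p + 1))) 1 =>
      baseForm e θ ^ (-(1 : ℝ) / 2) * ellWeight e p β θ := fun β hβ =>
    (((continuous_baseForm e).comp continuous_subtype_val).rpow_const fun θ =>
      Or.inl (baseForm_pos e (ne_zero_of_mem_unit_sphere θ)).ne').mul
      (continuous_sphere_ellWeight he.le p hβ)
  have hpos : ∀ β, 0 < β → ∀ x : EuclideanSpace ℝ (Fin (p + 1)), x ≠ 0 →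
      0 < baseForm e x ^ (-(1 : ℝ) / 2) * ellWeight e p β x := fun β hβ x hx =>
    mul_pos (Real.rpow_pos_of_pos (baseForm_pos e hx) _)
      (mul_pos (Real.rpow_pos_of_pos hβ _) (Real.rpow_pos_of_pos (ellForm_pos he.le hβ hx) _))
  have hlog : 0 < Real.log 2 := Real.log_pos one_lt_two
  have key : ∀ β : ℝ, 0 < β →
      Real.log 2 * ∫ θ : sphere (0 : EuclideanSpace ℝ (Fin (p + 1))) 1,
        baseForm e θ ^ (-(1 : ℝ) / 2) * ellWeight e p β θ ∂(volume.toSphere)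
        = C.toReal * ∫ s, profile p β s := by
    intro β hβ
    have h1 := setLIntegral_slab (p := p) hβ
    have hm : Measurable fun x : EuclideanSpace ℝ (Fin (p + 1)) =>
        ENNReal.ofReal (baseForm e x ^ (-(1 : ℝ) / 2) * ellWeight e p β x) := by
      have h1 := (continuous_baseForm e).measurable
      have h2 := (continuous_ellForm e β).measurable
      unfold ellWeight
      fun_prop
    have h2 := setLIntegral_shell_eq (volume : Measure (EuclideanSpace ℝ (Fin (p + 1)))) hm
      (fun r hr x => by
        have hx1 : 0 ≤ baseForm e x := Real.sqrt_nonneg _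
        rcases eq_or_ne x 0 with rfl | hx
        · have h0 : baseForm e (0 : EuclideanSpace ℝ (Fin (p + 1))) = 0 := by simp [baseForm]
          rw [smul_zero, h0, Real.zero_rpow (by norm_num)]
          simp
        have hx2 := ellForm_pos he.le hβ hx
        rw [← ENNReal.ofReal_mul (by positivity), finrank_euclideanSpace_fin, ellWeight, ellWeight,
          baseForm_smul, ellForm_smul, Real.mul_rpow (by positivity) hx1,
          Real.mul_rpow (by positivity) hx2.le]
        congr 1
        have e1 : r ^ (p + 1) * ((r ^ 2) ^ (-(1 : ℝ) / 2) * (r ^ 2) ^ (-(p : ℝ) / 2)) = 1 := by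
          rw [← Real.rpow_natCast r 2, ← Real.rpow_mul hr.le, ← Real.rpow_mul hr.le,
            ← Real.rpow_natCast r (p + 1), ← Real.rpow_add hr, ← Real.rpow_add hr]
          convert Real.rpow_zero r using 2
          push_cast; ring
        linear_combination (baseForm e x ^ (-(1 : ℝ) / 2) * (β ^ (-(1 : ℝ) / 2) *
          ellForm e β x ^ (-(p : ℝ) / 2))) * e1)
      (ρ := fun x => √(‖x‖ ^ 2 - inner ℝ e x ^ 2)) (by fun_prop) (fun x => Real.sqrt_nonneg _)
      (fun r hr x => by
        rw [norm_smul, inner_smul_right, Real.norm_of_nonneg hr.le,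
          show (r * ‖x‖) ^ 2 - (r * inner ℝ e x) ^ 2 = r ^ 2 * (‖x‖ ^ 2 - inner ℝ e x ^ 2) by ring,
          Real.sqrt_mul (by positivity), Real.sqrt_sq hr.le])
      (by
        have hV : (ℝ ∙ e) ≠ ⊤ := by
          intro h
          have := finrank_span_singleton (K := ℝ) (v := e) (by rintro h; simp [h] at he)
          rw [h, finrank_top, finrank_euclideanSpace_fin] at this
          omega
        filter_upwards [ae_toSphere_notMem_submodule volume hV] with θ hθ h0
        refine hθ ?_
        have hn : ‖(θ : EuclideanSpace ℝ (Fin (p + 1)))‖ = 1 := by simp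
        have h3 : ‖(θ : EuclideanSpace ℝ (Fin (p + 1))) - inner ℝ e (θ : EuclideanSpace ℝ (Fin (p + 1))) • e‖ ^ 2
            = ‖(θ : EuclideanSpace ℝ (Fin (p + 1)))‖ ^ 2
              - inner ℝ e (θ : EuclideanSpace ℝ (Fin (p + 1))) ^ 2 := by
          rw [norm_sub_sq_real, inner_smul_right, norm_smul, he, real_inner_comm]
          simp only [Real.norm_eq_abs, mul_one, sq_abs]; ring
        rw [Real.sqrt_eq_zero (by rw [← h3]; positivity), ← h3, sq_eq_zero_iff, norm_eq_zero,
          sub_eq_zero] at h0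
        rw [h0]
        exact Submodule.smul_mem _ _ (Submodule.mem_span_singleton_self e))
    have h3 := h2.symm.trans h1
    have h4 := congrArg ENNReal.toReal h3
    rw [ENNReal.toReal_mul, ENNReal.toReal_mul, ENNReal.toReal_ofReal hlog.le] at h4
    rw [integral_eq_lintegral_of_nonneg_ae (ae_of_all _ fun θ =>
        (hpos β hβ _ (ne_zero_of_mem_unit_sphere θ)).le) (hcont β hβ).aestronglyMeasurable,
      integral_eq_lintegral_of_nonneg_ae (ae_of_all _ fun s => (profile_pos _ _ s).le)
        (continuous_profile _ _).aestronglyMeasurable]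
    exact h4
  -- Positivity of the spherical integral at `β = 1` excludes both `C = 0` and `C = ⊤`, since
  -- `toReal` sends both to `0`.
  have hA : C.toReal ≠ 0 := by
    intro h
    have h1 := key 1 one_pos
    rw [h, zero_mul, mul_eq_zero, or_iff_right hlog.ne'] at h1
    have hθ : (e : EuclideanSpace ℝ (Fin (p + 1))) ∈ sphere (0 : EuclideanSpace ℝ (Fin (p + 1))) 1 := by
      simp [he]
    refine (integral_pos_of_integrable_nonneg_nonzero (hcont 1 one_pos) (x := ⟨e, hθ⟩)
      (integrable_sphere_of_continuous volume (hcont 1 one_pos))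
      (fun θ => (hpos 1 one_pos _ (ne_zero_of_mem_unit_sphere θ)).le) ?_).ne' h1
    exact (hpos 1 one_pos _ (ne_zero_of_mem_unit_sphere (⟨e, hθ⟩ : sphere _ _))).ne'
  refine ⟨C.toReal / Real.log 2, div_pos (ENNReal.toReal_nonneg.lt_of_ne' hA) hlog, fun β hβ => ?_⟩
  rw [div_mul_eq_mul_div, ← key β hβ, mul_div_cancel_left₀ _ hlog.ne']

theorem exists_signedWeight_integral_neg {p : ℕ} (hp : 4 ≤ p) :
    let e : EuclideanSpace ℝ (Fin (p + 1)) := EuclideanSpace.single 0 1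
    ∃ β : ℝ, 0 < β ∧ β < 1 ∧
      ∫ θ : sphere (0 : EuclideanSpace ℝ (Fin (p + 1))) 1,
        baseForm e θ ^ (-(1 : ℝ) / 2) * signedWeight e p β θ ∂(volume.toSphere) < 0 := by
  intro e
  have he : ‖e‖ = 1 := by simp [e]
  obtain ⟨A, hA, hint⟩ := exists_integral_sphere_eq_profile (p := p) (by omega)
  obtain ⟨β, hβ0, hβ1, hβ⟩ := exists_profile_integral_neg (p := p) (by exact_mod_cast hp)
  have h3 : 0 < 2 * β - β ^ 2 := by nlinarith
  have hi : ∀ b, 0 < b → Integrable (fun θ : sphere (0 : EuclideanSpace ℝ (Fin (p + 1))) 1 =>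
      baseForm e θ ^ (-(1 : ℝ) / 2) * ellWeight e p b θ) volume.toSphere := fun b hb =>
    integrable_sphere_of_continuous volume ((((continuous_baseForm e).comp
      continuous_subtype_val).rpow_const fun θ =>
      Or.inl (baseForm_pos e (ne_zero_of_mem_unit_sphere θ)).ne').mul
      (continuous_sphere_ellWeight he.le p hb))
  refine ⟨β, hβ0, hβ1, ?_⟩
  have h4 := integral_mul_add_mul_sub (hi β hβ0) (hi 1 one_pos) (hi _ h3) (1 - β) β
  rw [hint β hβ0, hint 1 one_pos, hint _ h3] at h4
  have h5 : ∫ θ : sphere (0 : EuclideanSpace ℝ (Fin (p + 1))) 1,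
        baseForm e θ ^ (-(1 : ℝ) / 2) * signedWeight e p β θ ∂(volume.toSphere)
      = A * ((1 - β) * (∫ s, profile p β s) + β * (∫ s, profile p 1 s)
        - ∫ s, profile p (2 * β - β ^ 2) s) := by
    rw [mul_sub, mul_add, mul_left_comm A, mul_left_comm A, ← h4]
    refine integral_congr_ae (ae_of_all _ fun θ => ?_)
    simp only [signedWeight]
    ring
  rw [h5]
  exact mul_neg_of_pos_of_neg hA hβ

end Slab

/-! ### Convexity of 2-homogeneous perturbations. -/

section Homogeneous

open Set Metric

variable {E : Type*} [NormedAddCommGroup E] [InnerProductSpace ℝ E]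

theorem fderiv_smul_of_homogeneous {h : E → ℝ} (hom : ∀ (r : ℝ) x, h (r • x) = r ^ 2 * h x)
    {r : ℝ} (hr : r ≠ 0) (x : E) : fderiv ℝ h (r • x) = r • fderiv ℝ h x := by
  have h1 : fderiv ℝ (fun y => h (r • y)) x = r • fderiv ℝ h (r • x) := fderiv_comp_smul r
  have h2 : (fun y => h (r • y)) = r ^ 2 • h := by funext y; simp [hom]
  rw [h2, fderiv_const_smul_field, Pi.smul_apply] at h1
  have h3 := congrArg (fun L => r⁻¹ • L) h1
  simp only [smul_smul, inv_mul_cancel₀ hr, one_smul] at h3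
  rw [← h3]
  congr 1
  field_simp

theorem fderiv_fderiv_smul_of_homogeneous {h : E → ℝ}
    (hom : ∀ (r : ℝ) x, h (r • x) = r ^ 2 * h x)
    {r : ℝ} (hr : r ≠ 0) {x : E} (hd : DifferentiableAt ℝ (fderiv ℝ h) x) :
    fderiv ℝ (fderiv ℝ h) (r • x) = fderiv ℝ (fderiv ℝ h) x := by
  have h1 : fderiv ℝ (fun y => fderiv ℝ h (r • y)) x = r • fderiv ℝ (fderiv ℝ h) (r • x) :=
    fderiv_comp_smul r
  have h2 : (fun y => fderiv ℝ h (r • y)) = r • fderiv ℝ h := by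
    funext y; exact fderiv_smul_of_homogeneous hom hr y
  rw [h2, (hd.hasFDerivAt.const_smul r).fderiv] at h1
  exact (smul_right_injective _ hr h1).symm

variable [FiniteDimensional ℝ E]

/-- The second derivative is homogeneous of degree `0`, so its bound on the compact unit sphere
holds everywhere off the origin. -/
theorem exists_fderiv_fderiv_bound {h : E → ℝ} (hom : ∀ (r : ℝ) x, h (r • x) = r ^ 2 * h x)
    (hc : ∀ x, x ≠ 0 → ContDiffAt ℝ 2 h x) :
    ∃ M : ℝ, 0 ≤ M ∧ ∀ x, x ≠ 0 → ‖fderiv ℝ (fderiv ℝ h) x‖ ≤ M := by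
  have hcont : ContinuousOn (fun x => ‖fderiv ℝ (fderiv ℝ h) x‖) (sphere 0 1) := by
    intro x hx
    have h1 := (hc x (ne_zero_of_mem_unit_sphere ⟨x, hx⟩)).fderiv_right (m := 1) (by norm_num)
    exact (h1.fderiv_right (m := 0) (by norm_num)).continuousAt.norm.continuousWithinAt
  obtain ⟨M, hM⟩ := (isCompact_sphere (0 : E) 1).bddAbove_image hcont
  refine ⟨max M 0, le_max_right _ _, fun x hx => ?_⟩
  have hx' : ‖x‖ ≠ 0 := norm_ne_zero_iff.2 hx
  rw [← fderiv_fderiv_smul_of_homogeneous hom (inv_ne_zero hx')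
    (((hc x hx).fderiv_right (m := 1) (by norm_num)).differentiableAt (by norm_num))]
  refine le_max_of_le_left (hM (mem_image_of_mem _ ?_))
  simp [norm_smul, hx']

theorem exists_abs_le_of_homogeneous {h : E → ℝ} (hom : ∀ (r : ℝ) x, h (r • x) = r ^ 2 * h x)
    (hc : ∀ x, x ≠ 0 → ContinuousAt h x) :
    ∃ M : ℝ, 0 ≤ M ∧ ∀ x, |h x| ≤ M * ‖x‖ ^ 2 := by
  have hcont : ContinuousOn (fun x => |h x|) (sphere 0 1) := fun x hx =>
    (hc x (ne_zero_of_mem_unit_sphere ⟨x, hx⟩)).abs.continuousWithinAt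
  obtain ⟨M, hM⟩ := (isCompact_sphere (0 : E) 1).bddAbove_image hcont
  refine ⟨max M 0, le_max_right _ _, fun x => ?_⟩
  rcases eq_or_ne x 0 with rfl | hx
  · have := hom 0 0
    simp at this
    simp [this]
  have hx' : ‖x‖ ≠ 0 := norm_ne_zero_iff.2 hx
  have h1 : |h (‖x‖⁻¹ • x)| ≤ max M 0 :=
    le_max_of_le_left (hM (mem_image_of_mem _ (by simp [norm_smul, hx'])))
  rw [hom, abs_mul, abs_of_nonneg (by positivity)] at h1
  have : |h x| = ‖x‖ ^ 2 * ((‖x‖⁻¹) ^ 2 * |h x|) := by field_simp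
  rw [this, mul_comm]
  gcongr

/-- A 2-homogeneous function that is `C²` away from the origin becomes convex after adding a
multiple of the squared norm. -/
theorem exists_convexOn_mul_norm_sq_add {h : E → ℝ}
    (hom : ∀ (r : ℝ) x, h (r • x) = r ^ 2 * h x) (hc : ∀ x, x ≠ 0 → ContDiffAt ℝ 2 h x) :
    ∃ M : ℝ, 0 ≤ M ∧ (∀ x, |h x| ≤ M * ‖x‖ ^ 2) ∧
      ConvexOn ℝ univ (fun x => M * ‖x‖ ^ 2 + h x) := by
  obtain ⟨M₁, hM₁, hb₁⟩ := exists_fderiv_fderiv_bound hom hc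
  obtain ⟨M₂, hM₂, hb₂⟩ := exists_abs_le_of_homogeneous hom fun x hx => (hc x hx).continuousAt
  have hb : ∀ x, |h x| ≤ (M₁ + M₂) * ‖x‖ ^ 2 := fun x =>
    (hb₂ x).trans (by gcongr; linarith)
  refine ⟨M₁ + M₂, by positivity, hb, convex_univ, fun x _ y _ a b ha hab' hab => ?_⟩
  simp only [smul_eq_mul]
  set M := M₁ + M₂ with hM
  set v := y - x with hv
  have hline : a • x + b • y = x + b • v := by
    rw [hv, eq_sub_iff_add_eq.2 hab]; module
  -- The form need not be `C²` at the origin. On a line through it the function is an explicit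
  -- parabola; on any other line the second derivative is available throughout.
  by_cases h0 : ∃ s : ℝ, x + s • v = 0
  · obtain ⟨s, hs⟩ := h0
    have hx : x = (-s) • v := by rw [neg_smul]; exact eq_neg_of_add_eq_zero_left hs
    have hy : y = (1 - s) • v := by
      have : y = x + v := by rw [hv]; abel
      rw [this, sub_smul, one_smul]; nth_rewrite 1 [hx]; module
    have hcv : 0 ≤ M * ‖v‖ ^ 2 + h v := by linarith [neg_abs_le (h v), hb v]
    have hval : ∀ c : ℝ, M * ‖c • v‖ ^ 2 + h (c • v) = c ^ 2 * (M * ‖v‖ ^ 2 + h v) := fun c => by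
      rw [norm_smul, hom, mul_pow, Real.norm_eq_abs, sq_abs]; ring
    rw [hline]
    have e1 : x + b • v = (b - s) • v := by nth_rewrite 1 [hx]; module
    rw [e1, hval, hx, hy, hval, hval]
    have e2 : a = 1 - b := by linarith
    have : (b - s) ^ 2 ≤ a * (-s) ^ 2 + b * (1 - s) ^ 2 := by
      rw [e2] at ha ⊢; nlinarith [mul_nonneg ha hab']
    nlinarith [mul_le_mul_of_nonneg_right this hcv]
  · push Not at h0
    have hd1 : ∀ s : ℝ, HasDerivAt (fun s : ℝ => x + s • v) v s := fun s => by
      simpa using ((hasDerivAt_id s).smul_const v).const_add x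
    have hG' : ∀ s : ℝ, HasDerivAt (fun s : ℝ => M * ‖x + s • v‖ ^ 2 + h (x + s • v))
        (M * (2 * inner ℝ (x + s • v) v) + fderiv ℝ h (x + s • v) v) s := fun s => by
      have hdiff : DifferentiableAt ℝ h (x + s • v) :=
        (hc _ (h0 s)).differentiableAt (by norm_num)
      exact ((hd1 s).norm_sq.const_mul M).add (hdiff.hasFDerivAt.comp_hasDerivAt s (hd1 s))
    have hG'' : ∀ s : ℝ, HasDerivAt
        (fun s : ℝ => M * (2 * inner ℝ (x + s • v) v) + fderiv ℝ h (x + s • v) v)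
        (M * (2 * inner ℝ v v) + fderiv ℝ (fderiv ℝ h) (x + s • v) v v) s := fun s => by
      have hdiff : DifferentiableAt ℝ (fderiv ℝ h) (x + s • v) :=
        ((hc _ (h0 s)).fderiv_right (m := 1) (by norm_num)).differentiableAt (by norm_num)
      have h2 : HasDerivAt (fun s : ℝ => inner ℝ (x + s • v) v) (inner ℝ v v) s := by
        simpa using (hd1 s).inner ℝ (hasDerivAt_const s v)
      have h3 : HasDerivAt (fun s : ℝ => fderiv ℝ h (x + s • v) v)
          (fderiv ℝ (fderiv ℝ h) (x + s • v) v v) s := by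
        have h4 := hdiff.hasFDerivAt.comp_hasDerivAt s (hd1 s)
        exact (ContinuousLinearMap.apply ℝ ℝ v).hasFDerivAt.comp_hasDerivAt s h4
      exact ((h2.const_mul 2).const_mul M).add h3
    have hconv : ConvexOn ℝ univ (fun s : ℝ => M * ‖x + s • v‖ ^ 2 + h (x + s • v)) := by
      refine convexOn_of_hasDerivWithinAt2_nonneg convex_univ
        (fun s _ => (hG' s).continuousAt.continuousWithinAt)
        (fun s _ => (hG' s).hasDerivWithinAt) (fun s _ => (hG'' s).hasDerivWithinAt) fun s _ => ?_
      have h1 : |fderiv ℝ (fderiv ℝ h) (x + s • v) v v| ≤ M₁ * ‖v‖ * ‖v‖ := by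
        rw [← Real.norm_eq_abs]
        refine (ContinuousLinearMap.le_opNorm₂ _ _ _).trans ?_
        gcongr
        exact hb₁ _ (h0 s)
      rw [real_inner_self_eq_norm_sq]
      have := neg_abs_le (fderiv ℝ (fderiv ℝ h) (x + s • v) v v)
      nlinarith [sq_nonneg ‖v‖, mul_nonneg hM₂ (sq_nonneg ‖v‖), mul_nonneg hM₁ (sq_nonneg ‖v‖)]
    have h1 := hconv.2 (mem_univ 0) (mem_univ 1) ha hab' hab
    simp only [smul_eq_mul, mul_zero, mul_one, zero_add, zero_smul, add_zero, one_smul] at h1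
    rw [hline]
    rwa [show x + v = y by rw [hv]; abel] at h1

end Homogeneous

/-! ### The regularized body and its perturbation. -/

section Forms

open Set Metric

variable {E : Type*} [NormedAddCommGroup E] [InnerProductSpace ℝ E]

/-- The regularized form `baseForm e x + δ |x|²`. -/
noncomputable def bodyForm (e : E) (δ : ℝ) (x : E) : ℝ := baseForm e x + δ * ‖x‖ ^ 2

/-- `signedWeight` made to have a strictly positive spherical transform. -/
noncomputable def shiftedWeight (e : E) (p β δ : ℝ) (x : E) : ℝ :=
  signedWeight e p β x + δ * ellWeight e p 1 x

/-- The 2-homogeneous direction in which `bodyForm` is perturbed. -/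
noncomputable def perturbation (e : E) (p β δ : ℝ) (x : E) : ℝ :=
  2 / p * (bodyForm e δ x ^ ((p + 2) / 2) * shiftedWeight e p β δ x)

theorem baseForm_nonneg (e x : E) : 0 ≤ baseForm e x := Real.sqrt_nonneg _

theorem bodyForm_pos (e : E) {δ : ℝ} (hδ : 0 ≤ δ) {x : E} (hx : x ≠ 0) : 0 < bodyForm e δ x :=
  add_pos_of_pos_of_nonneg (baseForm_pos e hx) (by positivity)

theorem bodyForm_smul (e : E) (δ r : ℝ) (x : E) :
    bodyForm e δ (r • x) = r ^ 2 * bodyForm e δ x := by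
  rw [bodyForm, bodyForm, baseForm_smul, norm_smul, mul_pow, Real.norm_eq_abs, sq_abs]; ring

theorem continuous_bodyForm (e : E) (δ : ℝ) : Continuous (bodyForm e δ) := by
  have := continuous_baseForm e
  unfold bodyForm; fun_prop

theorem norm_sq_sub_inner_sq_nonneg {e : E} (he : ‖e‖ = 1) (x : E) :
    0 ≤ ‖x‖ ^ 2 - inner ℝ e x ^ 2 := by
  have := abs_real_inner_le_norm e x
  rw [he, one_mul] at this
  rw [sub_nonneg, ← sq_abs (inner ℝ e x)]
  gcongr

/-- The form is the Euclidean norm of the pair `(a, t²)`, whose entries are nonnegative convex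
functions, and the norm is monotone on the positive quadrant. The plane is modelled by `ℂ`. -/
theorem convexOn_baseForm {e : E} (he : ‖e‖ = 1) : ConvexOn ℝ univ (baseForm e) := by
  refine ⟨convex_univ, fun x _ y _ a b ha hb hab => ?_⟩
  have hz : ∀ u v : ℝ, √(u ^ 2 + v ^ 2) = ‖(⟨u, v⟩ : ℂ)‖ := fun u v => by
    rw [Complex.norm_eq_sqrt_sq_add_sq]
  have ht : ∀ z : E, baseForm e z =
      √((‖z‖ ^ 2 - inner ℝ e z ^ 2) ^ 2 + (inner ℝ e z ^ 2) ^ 2) := fun z => by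
    rw [baseForm]; congr 2; ring
  have hb' : b = 1 - a := by linarith
  have h1 : ‖a • x + b • y‖ ^ 2 - inner ℝ e (a • x + b • y) ^ 2
      ≤ a * (‖x‖ ^ 2 - inner ℝ e x ^ 2) + b * (‖y‖ ^ 2 - inner ℝ e y ^ 2) := by
    have h := mul_nonneg (mul_nonneg ha hb) (norm_sq_sub_inner_sq_nonneg he (x - y))
    rw [norm_sub_sq_real, inner_sub_right] at h
    rw [norm_add_sq_real, norm_smul, norm_smul, inner_smul_left, inner_smul_right, inner_add_right,
      inner_smul_right, inner_smul_right, mul_pow, mul_pow, Real.norm_eq_abs, Real.norm_eq_abs,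
      sq_abs, sq_abs, RCLike.conj_to_real]
    rw [hb'] at h ⊢
    nlinarith
  have h2 : inner ℝ e (a • x + b • y) ^ 2 ≤ a * inner ℝ e x ^ 2 + b * inner ℝ e y ^ 2 := by
    have h := mul_nonneg (mul_nonneg ha hb) (sq_nonneg (inner ℝ e x - inner ℝ e y))
    rw [inner_add_right, inner_smul_right, inner_smul_right]
    rw [hb'] at h ⊢
    nlinarith
  rw [ht (a • x + b • y), ht x, ht y]
  simp only [smul_eq_mul]
  calc _ ≤ √((a * (‖x‖ ^ 2 - inner ℝ e x ^ 2) + b * (‖y‖ ^ 2 - inner ℝ e y ^ 2)) ^ 2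
          + (a * inner ℝ e x ^ 2 + b * inner ℝ e y ^ 2) ^ 2) := by
        refine Real.sqrt_le_sqrt (add_le_add ?_ ?_)
        · exact pow_le_pow_left₀ (norm_sq_sub_inner_sq_nonneg he _) h1 2
        · exact pow_le_pow_left₀ (sq_nonneg _) h2 2
    _ ≤ _ := by
        rw [hz, hz, hz]
        have e1 : (⟨a * (‖x‖ ^ 2 - inner ℝ e x ^ 2) + b * (‖y‖ ^ 2 - inner ℝ e y ^ 2),
            a * inner ℝ e x ^ 2 + b * inner ℝ e y ^ 2⟩ : ℂ)
            = a • (⟨‖x‖ ^ 2 - inner ℝ e x ^ 2, inner ℝ e x ^ 2⟩ : ℂ)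
              + b • (⟨‖y‖ ^ 2 - inner ℝ e y ^ 2, inner ℝ e y ^ 2⟩ : ℂ) := by
          apply Complex.ext <;> simp
        rw [e1]
        refine (norm_add_le _ _).trans (le_of_eq ?_)
        rw [norm_smul, norm_smul, Real.norm_of_nonneg ha, Real.norm_of_nonneg hb]

theorem convexOn_norm_sq : ConvexOn ℝ univ (fun x : E => ‖x‖ ^ 2) :=
  (convexOn_univ_norm).pow (fun x _ => norm_nonneg x) 2

theorem convexOn_bodyForm {e : E} (he : ‖e‖ = 1) {δ : ℝ} (hδ0 : 0 < δ) :
    ConvexOn ℝ univ (bodyForm e δ) :=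
  (convexOn_baseForm he).add (convexOn_norm_sq.smul hδ0.le)

theorem contDiffAt_baseForm (e : E) {x : E} (hx : x ≠ 0) : ContDiffAt ℝ 2 (baseForm e) x := by
  unfold baseForm
  refine ContDiffAt.sqrt ?_ ?_
  · exact ((((contDiff_norm_sq ℝ).sub ((contDiff_const.inner ℝ contDiff_id).pow 2)).pow 2).add
      ((contDiff_const.inner ℝ contDiff_id).pow 4)).contDiffAt
  · exact (Real.sqrt_pos.1 (baseForm_pos e hx)).ne'

theorem contDiffAt_bodyForm (e : E) (δ : ℝ) {x : E} (hx : x ≠ 0) :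
    ContDiffAt ℝ 2 (bodyForm e δ) x :=
  (contDiffAt_baseForm e hx).add (contDiff_const.mul (contDiff_norm_sq ℝ)).contDiffAt

theorem contDiffAt_ellWeight {e : E} (he : ‖e‖ ≤ 1) (p : ℝ) {β : ℝ} (hβ : 0 < β) {x : E}
    (hx : x ≠ 0) : ContDiffAt ℝ 2 (ellWeight e p β) x := by
  unfold ellWeight
  refine contDiffAt_const.mul (ContDiffAt.rpow_const_of_ne ?_ (ellForm_pos he hβ hx).ne')
  unfold ellForm
  exact ((contDiff_norm_sq ℝ).add
    (contDiff_const.mul ((contDiff_const.inner ℝ contDiff_id).pow 2))).contDiffAt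

theorem contDiffAt_perturbation {e : E} (he : ‖e‖ ≤ 1) (p : ℝ) {β δ : ℝ} (hβ : 0 < β) (hβ1 : β < 1)
    (hδ : 0 ≤ δ) {x : E} (hx : x ≠ 0) : ContDiffAt ℝ 2 (perturbation e p β δ) x := by
  have h3 : 0 < 2 * β - β ^ 2 := by nlinarith
  unfold perturbation shiftedWeight signedWeight
  refine contDiffAt_const.mul (ContDiffAt.mul ?_ ?_)
  · exact (contDiffAt_bodyForm e δ hx).rpow_const_of_ne (bodyForm_pos e hδ hx).ne'
  · exact (((contDiffAt_const.mul (contDiffAt_ellWeight he p hβ hx)).add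
      (contDiffAt_const.mul (contDiffAt_ellWeight he p one_pos hx))).sub
      (contDiffAt_ellWeight he p h3 hx)).add
      (contDiffAt_const.mul (contDiffAt_ellWeight he p one_pos hx))

theorem ellWeight_smul {e : E} (he : ‖e‖ ≤ 1) (p : ℝ) {β : ℝ} (hβ : 0 < β) {r : ℝ} {x : E}
    (hx : x ≠ 0) : ellWeight e p β (r • x) = (r ^ 2) ^ (-p / 2) * ellWeight e p β x := by
  unfold ellWeight
  rw [ellForm_smul, Real.mul_rpow (sq_nonneg r) (ellForm_pos he hβ hx).le]
  ring

theorem perturbation_smul {e : E} (he : ‖e‖ ≤ 1) {p : ℝ} (hp : 0 < p) {β δ : ℝ} (hβ : 0 < β)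
    (hβ1 : β < 1) (hδ : 0 ≤ δ) (r : ℝ) (x : E) :
    perturbation e p β δ (r • x) = r ^ 2 * perturbation e p β δ x := by
  have h3 : 0 < 2 * β - β ^ 2 := by nlinarith
  have hp2 : (p + 2) / 2 ≠ 0 := by positivity
  have h0 : bodyForm e δ 0 = 0 := by simpa using bodyForm_smul e δ 0 (0 : E)
  have hz : perturbation e p β δ 0 = 0 := by
    rw [perturbation, h0, Real.zero_rpow hp2]; simp
  rcases eq_or_ne x 0 with rfl | hx
  · rw [smul_zero, hz, mul_zero]
  rcases eq_or_ne r 0 with rfl | hr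
  · rw [zero_smul, hz]; simp
  have hr2 : 0 < r ^ 2 := by positivity
  rw [perturbation, perturbation, shiftedWeight, shiftedWeight, signedWeight, signedWeight,
    bodyForm_smul, Real.mul_rpow hr2.le (bodyForm_pos e hδ hx).le, ellWeight_smul he p hβ hx,
    ellWeight_smul he p one_pos hx, ellWeight_smul he p h3 hx]
  have e1 : (r ^ 2) ^ ((p + 2) / 2) * (r ^ 2) ^ (-p / 2) = r ^ 2 := by
    rw [← Real.rpow_add hr2, show (p + 2) / 2 + -p / 2 = 1 by ring, Real.rpow_one]
  linear_combination (2 / p * (bodyForm e δ x ^ ((p + 2) / 2) * ((1 - β) * ellWeight e p β x +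
    β * ellWeight e p 1 x - ellWeight e p (2 * β - β ^ 2) x + δ * ellWeight e p 1 x))) * e1

theorem ellWeight_one_of_norm_eq_one {e : E} (p : ℝ) {x : E} (hx : ‖x‖ = 1) :
    ellWeight e p 1 x = 1 := by
  simp [ellWeight, ellForm, hx]

end Forms

/-! ### Pointwise expansion of the powers of the perturbed form. -/

section Pointwise

/-- With `y = ε q^(p/2) (w + δ)`, the form `q (1 + 2y/p)` and its negative powers. -/
theorem rpow_perturbed_le {p q ε w δ : ℝ} (hp : 2 ≤ p) (hq : 0 < q) (hε : 0 ≤ ε)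
    (hy : |ε * (q ^ (p / 2) * (w + δ))| ≤ 1 / 2)
    (hy2 : 2 * ε * (q ^ (p / 2) * (w + δ) ^ 2) ≤ δ) :
    0 < q + ε * (2 / p * (q ^ ((p + 2) / 2) * (w + δ))) ∧
    (q + ε * (2 / p * (q ^ ((p + 2) / 2) * (w + δ)))) ^ (-p / 2) ≤ q ^ (-p / 2) - ε * w ∧
    q ^ (-(p + 1) / 2) - (p + 1) / p * ε * (q ^ (-(1 : ℝ) / 2) * (w + δ))
      ≤ (q + ε * (2 / p * (q ^ ((p + 2) / 2) * (w + δ)))) ^ (-(p + 1) / 2) := by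
  have hp0 : 0 < p := by linarith
  set m := q ^ (p / 2) with hm
  have hm0 : 0 < m := Real.rpow_pos_of_pos hq _
  set y := ε * (m * (w + δ)) with hyd
  obtain ⟨hy_l, hy_r⟩ := abs_le.1 hy
  have e1 : q ^ ((p + 2) / 2) = q * m := by
    rw [show (p + 2) / 2 = 1 + p / 2 by ring, Real.rpow_add hq, Real.rpow_one]
  have e2 : q + ε * (2 / p * (q ^ ((p + 2) / 2) * (w + δ))) = q * (1 + 2 / p * y) := by
    rw [e1, hyd]; ring
  have hs : -(1 / 2) ≤ 2 / p * y := by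
    have h1 : 2 / p ≤ 1 := by rw [div_le_one hp0]; exact hp
    have h2 : 0 < 2 / p := by positivity
    nlinarith
  have hs0 : 0 < 1 + 2 / p * y := by linarith
  have e3 : q ^ (-p / 2) = m⁻¹ := by rw [neg_div, Real.rpow_neg hq.le]
  refine ⟨by rw [e2]; positivity, ?_, ?_⟩
  · rw [e2, Real.mul_rpow hq.le hs0.le, e3, neg_div, Real.rpow_neg hs0.le]
    -- Bernoulli's inequality, with exponent `p / 2 ≥ 1`.
    have h1 : 1 + y ≤ (1 + 2 / p * y) ^ (p / 2) := by
      have := one_add_mul_self_le_rpow_one_add (s := 2 / p * y) (by linarith) (p := p / 2)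
        (by linarith)
      calc 1 + y = 1 + p / 2 * (2 / p * y) := by field_simp
        _ ≤ _ := this
    have h2 : ((1 + 2 / p * y) ^ (p / 2))⁻¹ ≤ 1 - y + 2 * y ^ 2 := by
      refine (inv_anti₀ (by linarith) h1).trans ?_
      rw [inv_le_iff_one_le_mul₀ (by linarith)]
      nlinarith [sq_nonneg y, mul_nonneg (sq_nonneg y) (by linarith : 0 ≤ 1 + 2 * y)]
    -- The first-order term lowers the power by `ε * (w + δ)`; the surplus `ε * δ` pays for the
    -- quadratic error.
    calc m⁻¹ * ((1 + 2 / p * y) ^ (p / 2))⁻¹ ≤ m⁻¹ * (1 - y + 2 * y ^ 2) := by gcongr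
      _ = m⁻¹ - ε * w + ε * (2 * ε * (m * (w + δ) ^ 2) - δ) := by
          rw [hyd]; field_simp; ring
      _ ≤ m⁻¹ - ε * w := by nlinarith [mul_nonneg hε (sub_nonneg.2 hy2)]
  · rw [e2, Real.mul_rpow hq.le hs0.le]
    have h1 : 1 - (p + 1) / p * y ≤ (1 + 2 / p * y) ^ (-(p + 1) / 2) := by
      rw [Real.rpow_def_of_pos hs0]
      have h2 := Real.log_le_sub_one_of_pos hs0
      have h3 := Real.add_one_le_exp (Real.log (1 + 2 / p * y) * (-(p + 1) / 2))
      have h4 : 1 - (p + 1) / p * y = 1 + (2 / p * y) * (-(p + 1) / 2) := by field_simp; ring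
      rw [h4]
      nlinarith
    have e4 : q ^ (-(p + 1) / 2) * m = q ^ (-(1 : ℝ) / 2) := by
      rw [hm, ← Real.rpow_add hq]; congr 1; ring
    calc _ = q ^ (-(p + 1) / 2) * (1 - (p + 1) / p * y) := by
          rw [← e4, hyd]; ring
      _ ≤ _ := by gcongr

end Pointwise

/-! ### The Busemann–Petty pair. -/

section Bodies

open MeasureTheory Set Metric Module

theorem isSymmConvexBody_sublevel {n : ℕ} {Q : EuclideanSpace ℝ (Fin n) → ℝ}
    (hconv : ConvexOn ℝ univ Q) (hom : ∀ (r : ℝ) x, Q (r • x) = r ^ 2 * Q x) {c : ℝ} (hc : 0 < c)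
    (hle : ∀ x, c * ‖x‖ ^ 2 ≤ Q x) : IsSymmConvexBody {x | Q x ≤ 1} := by
  have hcont : Continuous Q := hconv.locallyLipschitz.continuous
  have h0 : Q 0 = 0 := by simpa using hom 0 0
  refine ⟨by simpa using hconv.convex_le 1, ?_, ⟨0, ?_⟩, ?_⟩
  · refine isCompact_of_isClosed_isBounded (isClosed_le hcont continuous_const) ?_
    refine (isBounded_closedBall (x := (0 : EuclideanSpace ℝ (Fin n))) (r := √(1 / c))).subset ?_
    intro x hx
    rw [mem_closedBall_zero_iff]
    refine Real.le_sqrt_of_sq_le ?_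
    rw [le_div_iff₀ hc, mul_comm]
    exact (hle x).trans hx
  · rw [mem_interior_iff_mem_nhds]
    have : {x | Q x < 1} ∈ nhds (0 : EuclideanSpace ℝ (Fin n)) :=
      (isOpen_lt hcont continuous_const).mem_nhds (by rw [mem_ofPred_eq, h0]; exact one_pos)
    exact Filter.mem_of_superset this fun x hx => (show Q x ≤ 1 from le_of_lt hx)
  · ext x
    have := hom (-1) x
    rw [neg_one_smul] at this
    rw [Set.mem_neg, mem_ofPred_eq, mem_ofPred_eq, this]
    norm_num

theorem continuous_sphere_rpow {F : Type*} [NormedAddCommGroup F] {Q : F → ℝ} (hQ : Continuous Q)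
    (hpos : ∀ x, x ≠ 0 → 0 < Q x) (s : ℝ) :
    Continuous fun θ : sphere (0 : F) 1 => Q θ ^ s := by
  refine (hQ.comp continuous_subtype_val).rpow_const fun θ => Or.inl (hpos _ ?_).ne'
  have hθ : ‖(θ : F)‖ = 1 := by simp
  exact norm_ne_zero_iff.1 (by rw [hθ]; exact one_ne_zero)

theorem measureReal_section_le {E : Type*} [NormedAddCommGroup E] [InnerProductSpace ℝ E]
    [FiniteDimensional ℝ E] [MeasurableSpace E] [BorelSpace E] (V : Submodule ℝ E)
    (ν : Measure V) [ν.IsAddHaarMeasure] {p : ℕ} (hV : finrank ℝ V = p) (hp : 0 < p) {e : E}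
    (he : ‖e‖ = 1) {β : ℝ} (hβ : 0 < β) (hβ1 : β < 1) {ε : ℝ} (hε : 0 ≤ ε) {Q₁ Q₂ : E → ℝ}
    (h1 : Continuous Q₁) (h2 : Continuous Q₂) (p1 : ∀ x, x ≠ 0 → 0 < Q₁ x)
    (p2 : ∀ x, x ≠ 0 → 0 < Q₂ x) (s1 : ∀ (r : ℝ) x, Q₁ (r • x) = r ^ 2 * Q₁ x)
    (s2 : ∀ (r : ℝ) x, Q₂ (r • x) = r ^ 2 * Q₂ x)
    (hle : ∀ x, ‖x‖ = 1 → Q₂ x ^ (-(p : ℝ) / 2) ≤ Q₁ x ^ (-(p : ℝ) / 2) - ε * signedWeight e p β x) :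
    ν.real {x | Q₂ (x : E) ≤ 1} ≤ ν.real {x | Q₁ (x : E) ≤ 1} := by
  have : Nontrivial V := nontrivial_of_finrank_pos (R := ℝ) (by omega)
  set v := V.orthogonalProjectionOnto e with hv
  have hv1 : ‖v‖ ≤ 1 := (V.norm_orthogonalProjectionOnto_apply_le e).trans he.le
  have hne : ∀ x : V, x ≠ 0 → (x : E) ≠ 0 := fun x hx => by simpa using hx
  have hw := integral_sphere_signedWeight_nonneg ν hv1 hβ hβ1
  rw [hV] at hw
  rw [measureReal_sublevel_eq_integral_sphere ν (Q := fun x : V => Q₁ x)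
      (h1.comp continuous_subtype_val).measurable (fun x hx => p1 _ (hne x hx)) (fun r x => s1 r x),
    measureReal_sublevel_eq_integral_sphere ν (Q := fun x : V => Q₂ x)
      (h2.comp continuous_subtype_val).measurable (fun x hx => p2 _ (hne x hx)) (fun r x => s2 r x),
    hV]
  have i1 := integrable_sphere_of_continuous ν (continuous_sphere_rpow (F := V)
    (h1.comp continuous_subtype_val) (fun x hx => p1 _ (hne x hx)) (-(p : ℝ) / 2))
  have i2 := integrable_sphere_of_continuous ν (continuous_sphere_rpow (F := V)
    (h2.comp continuous_subtype_val) (fun x hx => p2 _ (hne x hx)) (-(p : ℝ) / 2))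
  have i3 := (integrable_sphere_of_continuous ν
    (continuous_sphere_signedWeight hv1 (p : ℝ) hβ hβ1)).const_mul ε
  refine mul_le_mul_of_nonneg_left ?_ (by positivity)
  calc _ ≤ ∫ θ : sphere (0 : V) 1, (Q₁ (θ : V) ^ (-(p : ℝ) / 2)
          - ε * signedWeight v p β θ) ∂ν.toSphere := by
        refine integral_mono i2 (i1.sub i3) fun θ => ?_
        have := hle ((θ : V) : E) (norm_eq_of_mem_sphere θ)
        rwa [signedWeight_coe] at this
    _ = ∫ θ : sphere (0 : V) 1, Q₁ (θ : V) ^ (-(p : ℝ) / 2) ∂ν.toSphere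
          - ε * ∫ θ : sphere (0 : V) 1, signedWeight v p β θ ∂ν.toSphere := by
        rw [← integral_const_mul]
        exact integral_sub i1 i3
    _ ≤ _ := by nlinarith [mul_nonneg hε hw]

/-- The integral depends continuously on `δ` and is negative at `δ = 0`, so it stays negative for
small `δ > 0`. -/
theorem exists_shift_integral_neg {p : ℕ} (hp : 4 ≤ p) :
    ∃ (e : EuclideanSpace ℝ (Fin (p + 1))) (β δ : ℝ), ‖e‖ = 1 ∧ 0 < β ∧ β < 1 ∧ 0 < δ ∧
      ∫ θ : sphere (0 : EuclideanSpace ℝ (Fin (p + 1))) 1,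
        bodyForm e δ θ ^ (-(1 : ℝ) / 2) * shiftedWeight e p β δ θ ∂(volume.toSphere) < 0 := by
  set e : EuclideanSpace ℝ (Fin (p + 1)) := EuclideanSpace.single 0 1
  have he : ‖e‖ = 1 := by simp [e]
  obtain ⟨β, hβ0, hβ1, hneg⟩ := exists_signedWeight_integral_neg hp
  have hpos : ∀ q : ℝ × sphere (0 : EuclideanSpace ℝ (Fin (p + 1))) 1,
      0 < baseForm e q.2 + |q.1| := fun q =>
    add_pos_of_pos_of_nonneg (baseForm_pos e (ne_zero_of_mem_unit_sphere q.2)) (abs_nonneg _)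
  -- `|δ|` keeps the base of the power positive for all real `δ`, so continuity holds on the whole
  -- line.
  have hcont : Continuous (Function.uncurry fun (δ : ℝ)
      (θ : sphere (0 : EuclideanSpace ℝ (Fin (p + 1))) 1) =>
      (baseForm e θ + |δ|) ^ (-(1 : ℝ) / 2) * (signedWeight e p β θ + δ)) := by
    refine Continuous.mul ?_ ?_
    · refine Continuous.rpow_const ?_ fun q => Or.inl (hpos q).ne'
      exact (((continuous_baseForm e).comp continuous_subtype_val).comp continuous_snd).add
        continuous_fst.abs
    · exact ((continuous_sphere_signedWeight he.le p hβ0 hβ1).comp continuous_snd).add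
        continuous_fst
  have hF := continuous_parametric_integral_of_continuous
    (μ := (volume : Measure (EuclideanSpace ℝ (Fin (p + 1)))).toSphere) hcont isCompact_univ
  simp only [Measure.restrict_univ] at hF
  have h1 : ∀ᶠ δ in nhdsWithin (0 : ℝ) (Ioi 0),
      ∫ θ : sphere (0 : EuclideanSpace ℝ (Fin (p + 1))) 1,
        (baseForm e θ + |δ|) ^ (-(1 : ℝ) / 2) * (signedWeight e p β θ + δ) ∂(volume.toSphere) < 0 := by
    refine ((hF.tendsto 0).mono_left nhdsWithin_le_nhds).eventually_lt_const ?_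
    simpa using hneg
  obtain ⟨δ, hδ, hδ0⟩ := (h1.and self_mem_nhdsWithin).exists
  have hδ0 : 0 < δ := hδ0
  refine ⟨e, β, δ, he, hβ0, hβ1, hδ0, lt_of_eq_of_lt (integral_congr_ae (ae_of_all _ fun θ => ?_)) hδ⟩
  have hθ : ‖(θ : EuclideanSpace ℝ (Fin (p + 1)))‖ = 1 := by simp
  simp only [bodyForm, shiftedWeight, hθ, ellWeight_one_of_norm_eq_one _ hθ, abs_of_pos hδ0]
  norm_num

theorem exists_bound_sphere {E : Type*} [NormedAddCommGroup E] [NormedSpace ℝ E]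
    [FiniteDimensional ℝ E] {f : E → ℝ}
    (hf : Continuous fun θ : sphere (0 : E) 1 => f θ) : ∃ B : ℝ, ∀ x, ‖x‖ = 1 → |f x| ≤ B := by
  obtain ⟨B, hB⟩ := (isCompact_range hf.abs).bddAbove
  exact ⟨B, fun x hx => hB ⟨⟨x, by simpa using hx⟩, rfl⟩⟩

theorem eventually_mul_le (c : ℝ) {b : ℝ} (hb : 0 < b) :
    ∀ᶠ ε in nhdsWithin (0 : ℝ) (Ioi 0), ε * c ≤ b := by
  have hc : Continuous fun ε : ℝ => ε * c := by fun_prop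
  exact ((hc.tendsto' 0 0 (by simp)).mono_left nhdsWithin_le_nhds).eventually_le_const hb

section Perturbed

variable {E : Type*} [NormedAddCommGroup E] [InnerProductSpace ℝ E] [FiniteDimensional ℝ E]
  {e : E} {p β δ : ℝ}

theorem eventually_rpow_bounds (he : ‖e‖ = 1) (hp : 2 ≤ p) (hβ0 : 0 < β)
    (hβ1 : β < 1) (hδ0 : 0 < δ) : ∀ᶠ ε in nhdsWithin (0 : ℝ) (Ioi 0), ∀ x : E, ‖x‖ = 1 →
      (bodyForm e δ x + ε * perturbation e p β δ x) ^ (-p / 2)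
        ≤ bodyForm e δ x ^ (-p / 2) - ε * signedWeight e p β x ∧
      bodyForm e δ x ^ (-(p + 1) / 2) - (p + 1) / p * ε *
        (bodyForm e δ x ^ (-(1 : ℝ) / 2) * shiftedWeight e p β δ x)
        ≤ (bodyForm e δ x + ε * perturbation e p β δ x) ^ (-(p + 1) / 2) := by
  have hwc : Continuous fun θ : sphere (0 : E) 1 => signedWeight e p β θ :=
    continuous_sphere_signedWeight he.le p hβ0 hβ1
  have hmc : Continuous fun θ : sphere (0 : E) 1 => bodyForm e δ θ ^ (p / 2) :=
    continuous_sphere_rpow (continuous_bodyForm e δ) (fun x hx => bodyForm_pos e hδ0.le hx) _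
  obtain ⟨B₁, hB₁⟩ := exists_bound_sphere
    (f := fun x : E => bodyForm e δ x ^ (p / 2) * (signedWeight e p β x + δ))
    (hmc.mul (hwc.add_const δ))
  obtain ⟨B₂, hB₂⟩ := exists_bound_sphere
    (f := fun x : E => bodyForm e δ x ^ (p / 2) * (signedWeight e p β x + δ) ^ 2)
    (hmc.mul ((hwc.add_const δ).pow 2))
  filter_upwards [eventually_mul_le B₁ (half_pos one_pos), eventually_mul_le (2 * B₂) hδ0,
    self_mem_nhdsWithin] with ε h1 h2 (h3 : 0 < ε) x hx
  have hsw : shiftedWeight e p β δ x = signedWeight e p β x + δ := by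
    rw [shiftedWeight, ellWeight_one_of_norm_eq_one _ hx, mul_one]
  have hx0 : x ≠ 0 := norm_ne_zero_iff.1 (by rw [hx]; exact one_ne_zero)
  have := rpow_perturbed_le (q := bodyForm e δ x) (ε := ε) (w := signedWeight e p β x) (δ := δ)
    hp (bodyForm_pos e hδ0.le hx0) h3.le
    (by
      rw [abs_mul, abs_of_pos h3]
      exact (mul_le_mul_of_nonneg_left (hB₁ x hx) h3.le).trans h1)
    (by
      have h4 := (le_abs_self _).trans (hB₂ x hx)
      calc _ ≤ 2 * ε * B₂ := by gcongr
        _ = ε * (2 * B₂) := by ring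
        _ ≤ δ := h2)
  rw [perturbation, hsw]
  exact this.2

/-- Of the term `δ * ‖x‖ ^ 2`, the share `ε * M * ‖x‖ ^ 2` makes `ε` times the perturbation convex.
Since `ε * M ≤ δ / 2`, at least half is left for the lower bound. -/
theorem eventually_convexOn_perturbed (he : ‖e‖ = 1) (hp : 0 < p) (hβ0 : 0 < β)
    (hβ1 : β < 1) (hδ0 : 0 < δ) : ∀ᶠ ε in nhdsWithin (0 : ℝ) (Ioi 0),
      ConvexOn ℝ univ (fun x => bodyForm e δ x + ε * perturbation e p β δ x) ∧
      ∀ x, δ / 2 * ‖x‖ ^ 2 ≤ bodyForm e δ x + ε * perturbation e p β δ x := by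
  obtain ⟨M, -, hMb, hMc⟩ := exists_convexOn_mul_norm_sq_add
    (perturbation_smul he.le hp hβ0 hβ1 hδ0.le)
    fun x hx => contDiffAt_perturbation he.le p hβ0 hβ1 hδ0.le hx
  filter_upwards [eventually_mul_le M (half_pos hδ0), self_mem_nhdsWithin] with ε h1 (h2 : 0 < ε)
  constructor
  · have h3 : 0 ≤ δ - ε * M := by linarith
    have := ((convexOn_baseForm he).add (convexOn_norm_sq.smul h3)).add (hMc.smul h2.le)
    refine this.congr fun x _ => ?_
    simp only [Pi.add_apply, smul_eq_mul, bodyForm]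
    ring
  · intro x
    have h3 := mul_le_mul_of_nonneg_left
      ((neg_abs_le (perturbation e p β δ x)).trans' (neg_le_neg (hMb x))) h2.le
    have h4 := mul_le_mul_of_nonneg_right h1 (sq_nonneg ‖x‖)
    have h5 := baseForm_nonneg e x
    simp only [bodyForm]
    linarith

theorem measureReal_lt_of_integral_neg [MeasurableSpace E] [BorelSpace E] (μ : Measure E)
    [μ.IsAddHaarMeasure] {d : ℕ} (hd : finrank ℝ E = d + 1) {Q₁ Q₂ v : E → ℝ}
    (h1 : Continuous Q₁) (h2 : Continuous Q₂) (p1 : ∀ x, x ≠ 0 → 0 < Q₁ x)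
    (p2 : ∀ x, x ≠ 0 → 0 < Q₂ x) (s1 : ∀ (r : ℝ) x, Q₁ (r • x) = r ^ 2 * Q₁ x)
    (s2 : ∀ (r : ℝ) x, Q₂ (r • x) = r ^ 2 * Q₂ x)
    (hv : Continuous fun θ : sphere (0 : E) 1 => v θ) {c : ℝ} (hc : 0 < c)
    (hneg : ∫ θ : sphere (0 : E) 1, v θ ∂μ.toSphere < 0)
    (hle : ∀ x, ‖x‖ = 1 →
      Q₁ x ^ (-((d : ℝ) + 1) / 2) - c * v x ≤ Q₂ x ^ (-((d : ℝ) + 1) / 2)) :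
    μ.real {x | Q₁ x ≤ 1} < μ.real {x | Q₂ x ≤ 1} := by
  have : Nontrivial E := nontrivial_of_finrank_pos (R := ℝ) (by omega)
  have m1 := measureReal_sublevel_eq_integral_sphere μ h1.measurable p1 s1
  have m2 := measureReal_sublevel_eq_integral_sphere μ h2.measurable p2 s2
  rw [hd] at m1 m2
  push_cast at m1 m2
  rw [m1, m2]
  have i1 := integrable_sphere_of_continuous μ
    (continuous_sphere_rpow h1 p1 (-((d : ℝ) + 1) / 2))
  have i2 := integrable_sphere_of_continuous μ
    (continuous_sphere_rpow h2 p2 (-((d : ℝ) + 1) / 2))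
  have i3 := (integrable_sphere_of_continuous μ hv).const_mul c
  refine mul_lt_mul_of_pos_left ?_ (by positivity)
  calc ∫ θ : sphere (0 : E) 1, Q₁ θ ^ (-((d : ℝ) + 1) / 2) ∂μ.toSphere
      < ∫ θ : sphere (0 : E) 1, Q₁ θ ^ (-((d : ℝ) + 1) / 2) ∂μ.toSphere
        - c * ∫ θ : sphere (0 : E) 1, v θ ∂μ.toSphere := by
        have := mul_neg_of_pos_of_neg hc hneg
        linarith
    _ = ∫ θ : sphere (0 : E) 1, (Q₁ θ ^ (-((d : ℝ) + 1) / 2) - c * v θ) ∂μ.toSphere := by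
        rw [← integral_const_mul]
        exact (integral_sub i1 i3).symm
    _ ≤ _ := integral_mono (i1.sub i3) i2 fun θ => hle θ (norm_eq_of_mem_sphere θ)

end Perturbed

/-- `L` is the unit ball of `bodyForm` and `K` that of the perturbed form. One small `ε` serves
convexity, the sections and the volume. -/
theorem exists_body_pair {p : ℕ} (hp : 4 ≤ p) :
    ∃ K L : Set (EuclideanSpace ℝ (Fin (p + 1))), IsSymmConvexBody K ∧ IsSymmConvexBody L ∧
      (∀ ξ : EuclideanSpace ℝ (Fin (p + 1)), ‖ξ‖ = 1 →
        (@volume (Submodule.span ℝ {ξ})ᗮ measureSpaceOfInnerProductSpace)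
          {x | (x : EuclideanSpace ℝ (Fin (p + 1))) ∈ K} ≤
        (@volume (Submodule.span ℝ {ξ})ᗮ measureSpaceOfInnerProductSpace)
          {x | (x : EuclideanSpace ℝ (Fin (p + 1))) ∈ L}) ∧
      volume L < volume K := by
  obtain ⟨e, β, δ, he, hβ0, hβ1, hδ0, hneg⟩ := exists_shift_integral_neg hp
  have hp0 : (0 : ℝ) < p := by exact_mod_cast (by omega : 0 < p)
  have hp2 : (2 : ℝ) ≤ p := by exact_mod_cast (by omega : 2 ≤ p)
  obtain ⟨ε, ⟨hpt, hconv₂, hlow₂⟩, hε0⟩ := (((eventually_rpow_bounds he hp2 hβ0 hβ1 hδ0).and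
    (eventually_convexOn_perturbed he hp0 hβ0 hβ1 hδ0)).and self_mem_nhdsWithin).exists
  have hε0 : 0 < ε := hε0
  set Q₁ := bodyForm e δ with hQ₁
  set Q₂ : EuclideanSpace ℝ (Fin (p + 1)) → ℝ :=
    fun x => bodyForm e δ x + ε * perturbation e p β δ x with hQ₂
  have hom₂ : ∀ (r : ℝ) x, Q₂ (r • x) = r ^ 2 * Q₂ x := fun r x => by
    simp only [hQ₂, perturbation_smul he.le hp0 hβ0 hβ1 hδ0.le, bodyForm_smul]; ring
  have hlow₁ : ∀ x, δ * ‖x‖ ^ 2 ≤ Q₁ x := fun x => le_add_of_nonneg_left (baseForm_nonneg e x)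
  have hpos₁ : ∀ x, x ≠ 0 → 0 < Q₁ x := fun x hx => bodyForm_pos e hδ0.le hx
  have hpos₂ : ∀ x, x ≠ 0 → 0 < Q₂ x := fun x hx =>
    (mul_pos (half_pos hδ0) (pow_pos (norm_pos_iff.2 hx) 2)).trans_le (hlow₂ x)
  have hcont₁ : Continuous Q₁ := continuous_bodyForm e δ
  have hcont₂ : Continuous Q₂ := hconv₂.locallyLipschitz.continuous
  have hK : IsSymmConvexBody {x | Q₂ x ≤ 1} :=
    isSymmConvexBody_sublevel hconv₂ hom₂ (half_pos hδ0) hlow₂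
  have hL : IsSymmConvexBody {x | Q₁ x ≤ 1} :=
    isSymmConvexBody_sublevel (convexOn_bodyForm he hδ0) (bodyForm_smul e δ) hδ0 hlow₁
  refine ⟨_, _, hK, hL, fun ξ hξ => ?_, ?_⟩
  · have hξ0 : ξ ≠ 0 := norm_ne_zero_iff.1 (by rw [hξ]; exact one_ne_zero)
    have hfact : Fact (finrank ℝ (EuclideanSpace ℝ (Fin (p + 1))) = p + 1) := ⟨by simp⟩
    have hc : ∀ A : Set (EuclideanSpace ℝ (Fin (p + 1))), IsCompact A →
        IsCompact {x : (Submodule.span ℝ {ξ})ᗮ | (x : EuclideanSpace ℝ (Fin (p + 1))) ∈ A} :=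
      fun A hA => ((Submodule.closed_of_finiteDimensional
        (Submodule.span ℝ {ξ})ᗮ).isClosedEmbedding_subtypeVal).isCompact_preimage hA
    have := measureReal_section_le (Submodule.span ℝ {ξ})ᗮ
      (@volume (Submodule.span ℝ {ξ})ᗮ measureSpaceOfInnerProductSpace)
      (Submodule.finrank_orthogonal_span_singleton hξ0) (by omega) he hβ0 hβ1 hε0.le
      hcont₁ hcont₂ hpos₁ hpos₂ (bodyForm_smul e δ) hom₂ fun x hx => (hpt x hx).1
    exact (ENNReal.toReal_le_toReal (hc _ hK.isCompact).measure_lt_top.ne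
      (hc _ hL.isCompact).measure_lt_top.ne).1 this
  · refine (ENNReal.toReal_lt_toReal hL.isCompact.measure_lt_top.ne
      hK.isCompact.measure_lt_top.ne).1 ?_
    refine measureReal_lt_of_integral_neg volume (by simp) hcont₁ hcont₂ hpos₁ hpos₂
      (bodyForm_smul e δ) hom₂
      ((continuous_sphere_rpow hcont₁ hpos₁ (-(1 : ℝ) / 2)).mul
        ((continuous_sphere_signedWeight he.le p hβ0 hβ1).add
          (continuous_const.mul (continuous_sphere_ellWeight he.le p one_pos))))
      (c := ((p : ℝ) + 1) / p * ε) (by positivity) hneg fun x hx => (hpt x hx).2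

end Bodies

theorem theorem3 (n : ℕ) (hn : 5 ≤ n) :
    ∃ (K L : Set (EuclideanSpace ℝ (Fin n))) (φ : ℝ → ℝ)
      (μ : MeasureTheory.Measure (EuclideanSpace ℝ (Fin n))),
      IsSymmConvexBody K ∧ IsSymmConvexBody L ∧
      (∀ s, 0 ≤ s → 0 ≤ φ s) ∧ StrictMonoOn φ (Set.Ici 0) ∧ ConvexOn ℝ (Set.Ici 0) φ ∧
      μ = MeasureTheory.volume.withDensity (normDensity φ L) ∧
      MeasureTheory.IsProbabilityMeasure μ ∧ IsLogConcaveMeasure μ ∧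
      (∀ ξ : EuclideanSpace ℝ (Fin n), ‖ξ‖ = 1 → ∀ r : ℝ, 0 < r →
        sectionMeasure (normDensity φ L) (r • K) ξ ≤ sectionMeasure (normDensity φ L) (r • L) ξ) ∧
      μ L < μ K := by
  obtain ⟨p, rfl⟩ : ∃ p, n = p + 1 := ⟨n - 1, by omega⟩
  obtain ⟨K, L, hK, hL, hsec, hvol⟩ := exists_body_pair (p := p) (by omega)
  obtain ⟨φ, μ, h⟩ := exists_logConcave_of_section_le (by omega) hK hL hsec hvol
  exact ⟨K, L, φ, μ, hK, hL, h⟩
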